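/- Let $k$ be a field of characteristic zero and $k^a$ an algebraic closure of $k$. A variety over a field is a separated scheme of finite type over it. A cover of curves is a non-constant $k^a$-morphism $\varphi : Y \to C\times_k k^a$, where $C$ is a smooth projective geometrically integral curve over $k$ and $Y$ is a smooth projective integral curve over $k^a$. Let $X$ be a $k^a$-variety or a cover of curves. Definitions. (a) $X$ has $k$ as field of moduli if for every $k$-automorphism $\sigma$ of $k^a$ the morphism $\mathrm{Spec}(\sigma)$ lifts to an automorphism of the scheme $X$ (for a cover $\varphi : Y\to C\times_k k^a$: to an automorphism of the scheme $Y$ compatible with the map $Y \to C$). (b) Let $l$ be an algebraic extension of $k$ and $e : l \to k^a$ a $k$-embedding. A model of $X$ over $l$ along $e$ is an $l$-variety $X_l$ (for covers of $C$: a smooth projective geometrically integral $l$-curve with a non-constant $l$-morphism to $C\times_k l$) whose base change along $e$ is isomorphic to $X$. A subfield $k\subset l\subset k^a$ is a field of definition of $X$ if $X$ has a model over $l$ along the inclusion $l \subset k^a$. There is a "model" of $X$ over $l$ if $X$ has a model over $l$ along some $k$-embedding $l\to k^a$. (c) There is a descent obstruction for $X$ if $X$ has $k$ as field of moduli but $k$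 is not a field of definition of $X$. (d) $\mathcal M_X$ is the category fibered over the site of finite étale $k$-schemes (coverings are the jointly surjective families) whose objects over $\mathrm{Spec}(l)$, $l$ a finite étale $k$-algebra, are the disjoint unions of "models" of $X$ over the connected components of $\mathrm{Spec}(l)$, and whose morphisms are the cartesian squares over $\mathrm{Spec}(k)$ (for covers of $C$: compatible with the maps to $C$). Proposition. Let $X$ and $Y$ be two objects, each of them a $k^a$-variety or a cover of curves, and let $F : \mathcal M_X \to \mathcal M_Y$ be a cartesian functor over the site of finite étale $k$-schemes. (1) If $X$ has $k$ as field of moduli, then so has $Y$. (2) For every field $k\subset l\subset k^a$: if there is a "model" of $X$ over $l$, then there is a "model" of $Y$ over $l$. If moreover $X$ has $k$ as field of moduli, then every field of definition $l$ of $X$ is a field of definition of $Y$. (3) Suppose that $X$ has $k$ as field of moduli, that $F$ is fully faithful, and that $\mathcal M_X$ (if $X$ is a variety) and $\mathcal M_Y$ (if $Y$ is a variety) are stacks. Then a field $k\subset l\subset k^a$ is a field of definition of $X$ if and only if it is a field of definition of $Y$; in particular there is a descent obstruction for $X$ if and only if there is one for $Y$. Lemma. Let $\mathcal X$ and $\mathcal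 Y$ be gerbes over a site and let $F : \mathcal X \to \mathcal Y$ be a cartesian functor over the site. If $F$ is fully faithful, then $F$ is essentially surjective (on every fiber). -/

import Mathlib

open CategoryTheory CategoryTheory.Functor CategoryTheory.Limits AlgebraicGeometry

universe u v₁ u₁ v₂ u₂ v₃ u₃

noncomputable section

/-! ### Stacks and gerbes over a site, as fibered categories -/

namespace FibStack

variable {𝒮 : Type u₁} [Category.{v₁} 𝒮]

/-- A descent datum relative to a sieve `R` on `U`: an object over `V` for every `f : V ⟶ U` in
`R`, and a compatible system of cartesian arrows between them (a cartesian section over `R`).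
When `R` is generated by a covering family `(Uᵢ ⟶ U)`, this is the same as a family of objects over
the `Uᵢ` with isomorphisms over the `Uᵢ ×_U Uⱼ` satisfying the cocycle condition. -/
structure DescentDatum {𝒳 : Type u₂} [Category.{v₂} 𝒳] (p : 𝒳 ⥤ 𝒮) {U : 𝒮} (R : Sieve U) where
  obj {V : 𝒮} (f : V ⟶ U) (hf : R f) : 𝒳
  map {W V : 𝒮} (e : W ⟶ U) (he : R e) (f : V ⟶ U) (hf : R f) (g : W ⟶ V) (w : g ≫ f = e) :
    obj e he ⟶ obj f hf
  isStronglyCartesian_map {W V : 𝒮} (e : W ⟶ U) (he : R e) (f : V ⟶ U) (hf : R f) (g : W ⟶ V)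
    (w : g ≫ f = e) : p.IsStronglyCartesian g (map e he f hf g w)
  map_id {V : 𝒮} (f : V ⟶ U) (hf : R f) : map f hf f hf (𝟙 V) (Category.id_comp f) = 𝟙 _
  map_comp {W' W V : 𝒮} (d : W' ⟶ U) (hd : R d) (e : W ⟶ U) (he : R e) (f : V ⟶ U) (hf : R f)
    (h : W' ⟶ W) (g : W ⟶ V) (w : h ≫ e = d) (w' : g ≫ f = e) :
    map d hd e he h w ≫ map e he f hf g w' =
      map d hd f hf (h ≫ g) (by rw [Category.assoc, w', w])

/-- The descent datum comes from an object over `U`. -/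
def DescentDatum.IsEffective {𝒳 : Type u₂} [Category.{v₂} 𝒳] {p : 𝒳 ⥤ 𝒮} {U : 𝒮} {R : Sieve U}
    (D : DescentDatum p R) : Prop :=
  ∃ (x : 𝒳) (c : ∀ {V : 𝒮} (f : V ⟶ U) (hf : R f), D.obj f hf ⟶ x),
    p.obj x = U ∧
    (∀ {V : 𝒮} (f : V ⟶ U) (hf : R f), p.IsStronglyCartesian f (c f hf)) ∧
    ∀ {W V : 𝒮} (e : W ⟶ U) (he : R e) (f : V ⟶ U) (hf : R f) (g : W ⟶ V) (w : g ≫ f = e),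
      D.map e he f hf g w ≫ c f hf = c e he

/-- A compatible family of morphisms from the restrictions of `a` along the arrows of `R` to the
restrictions of `b`. A morphism `f^*a ⟶ f^*b` in the fiber over `V` is recorded as an arrow
`f^*a ⟶ b` over `f : V ⟶ U`, for every choice `c : a' ⟶ a` of a pullback `f^*a`. -/
structure LocalHom {𝒳 : Type u₂} [Category.{v₂} 𝒳] (p : 𝒳 ⥤ 𝒮) {U : 𝒮} (R : Sieve U)
    (a b : 𝒳) where
  app {V : 𝒮} (f : V ⟶ U) (hf : R f) {a' : 𝒳} (c : a' ⟶ a) (hc : p.IsStronglyCartesian f c) :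
    a' ⟶ b
  isHomLift_app {V : 𝒮} (f : V ⟶ U) (hf : R f) {a' : 𝒳} (c : a' ⟶ a)
    (hc : p.IsStronglyCartesian f c) : p.IsHomLift f (app f hf c hc)
  comp_app {W V : 𝒮} (e : W ⟶ U) (he : R e) (f : V ⟶ U) (hf : R f) (g : W ⟶ V) (w : g ≫ f = e)
    {a'' a' : 𝒳} (c' : a'' ⟶ a) (hc' : p.IsStronglyCartesian e c') (c : a' ⟶ a)
    (hc : p.IsStronglyCartesian f c) (d : a'' ⟶ a') (hd : p.IsHomLift g d) (hdc : d ≫ c = c') :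
    d ≫ app f hf c hc = app e he c' hc'

/-- A stack over the site `(𝒮, J)`: a fibered category such that, for every covering `R` of every
`U`, the functor from the fiber over `U` to the category of descent data relative to `R` is fully
faithful (`existsUnique_glue`) and essentially surjective (`isEffective`). -/
structure IsStack (J : GrothendieckTopology 𝒮) (𝒳 : BasedCategory.{v₂, u₂} 𝒮) : Prop where
  isFibered : 𝒳.p.IsFibered
  existsUnique_glue {U : 𝒮} (R : Sieve U) (hR : R ∈ J U) (a b : 𝒳.obj) (ha : 𝒳.p.obj a = U)
    (hb : 𝒳.p.obj b = U) (ψ : LocalHom 𝒳.p R a b) :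
    ∃! χ : a ⟶ b, 𝒳.p.IsHomLift (𝟙 U) χ ∧
      ∀ {V : 𝒮} (f : V ⟶ U) (hf : R f) {a' : 𝒳.obj} (c : a' ⟶ a)
        (hc : 𝒳.p.IsStronglyCartesian f c), c ≫ χ = ψ.app f hf c hc
  isEffective {U : 𝒮} (R : Sieve U) (hR : R ∈ J U) (D : DescentDatum 𝒳.p R) : D.IsEffective

/-- A gerbe over the site `(𝒮, J)`: a stack in groupoids that is locally non-empty and locally
connected. In `locally_connected`, the arrows `z ⟶ x` and `z ⟶ y` exhibit `z` as a common pullback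
of `x` and `y` along `f`. -/
structure IsGerbe (J : GrothendieckTopology 𝒮) (𝒳 : BasedCategory.{v₂, u₂} 𝒮) : Prop where
  isStack : IsStack J 𝒳
  locally_nonempty (U : 𝒮) : ∃ R ∈ J U, ∀ {V : 𝒮} (f : V ⟶ U), R f → Nonempty (𝒳.p.Fiber V)
  locally_connected {U : 𝒮} (x y : 𝒳.obj) (hx : 𝒳.p.obj x = U) (hy : 𝒳.p.obj y = U) :
    ∃ R ∈ J U, ∀ {V : 𝒮} (f : V ⟶ U), R f →
      ∃ (z : 𝒳.obj) (a : z ⟶ x) (b : z ⟶ y),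
        𝒳.p.IsStronglyCartesian f a ∧ 𝒳.p.IsStronglyCartesian f b
  isGroupoid_fiber (U : 𝒮) : IsGroupoid (𝒳.p.Fiber U)

/-- A cartesian functor: a functor over `𝒮` that preserves cartesian arrows. -/
def IsCartesianFunctor {𝒳 : BasedCategory.{v₂, u₂} 𝒮} {𝒴 : BasedCategory.{v₃, u₃} 𝒮}
    (F : BasedFunctor 𝒳 𝒴) : Prop :=
  ∀ {V U : 𝒮} (f : V ⟶ U) {a b : 𝒳.obj} (c : a ⟶ b),
    𝒳.p.IsStronglyCartesian f c → 𝒴.p.IsStronglyCartesian f (F.map c)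

/-- Essential surjectivity, fiber by fiber: every object over `U` is isomorphic, by an isomorphism
over `𝟙 U`, to the image of an object over `U`. -/
def IsFiberwiseEssSurj {𝒳 : BasedCategory.{v₂, u₂} 𝒮} {𝒴 : BasedCategory.{v₃, u₃} 𝒮}
    (F : BasedFunctor 𝒳 𝒴) : Prop :=
  ∀ (U : 𝒮) (y : 𝒴.obj), 𝒴.p.obj y = U →
    ∃ (x : 𝒳.obj) (i : F.obj x ≅ y), 𝒳.p.obj x = U ∧ 𝒴.p.IsHomLift (𝟙 U) i.hom

end FibStack

/-! ### The finite étale site of a field -/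

/-- The finite étale schemes over `Spec k`: the spectra of the finite étale `k`-algebras. -/
structure FEt (k : Type u) [Field k] : Type (u + 1) where
  toOver : Over (Spec (.of k))
  isFinite : IsFinite toOver.hom
  etale : Etale toOver.hom

/-- Morphisms of finite étale `k`-schemes are the morphisms of `k`-schemes. -/
instance (k : Type u) [Field k] : Category.{u} (FEt k) where
  Hom U V := U.toOver ⟶ V.toOver
  id U := 𝟙 U.toOver
  comp f g := CategoryStruct.comp (obj := Over (Spec (.of k))) f g

/-- A morphism of `FEt k` as a morphism of `k`-schemes. -/
def FEt.homToOver {k : Type u} [Field k] {U V : FEt k} (f : U ⟶ V) : U.toOver ⟶ V.toOver := f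

@[simp] lemma FEt.homToOver_id {k : Type u} [Field k] (U : FEt k) :
    FEt.homToOver (𝟙 U) = 𝟙 U.toOver := rfl

@[simp] lemma FEt.homToOver_comp {k : Type u} [Field k] {U V W : FEt k} (f : U ⟶ V) (g : V ⟶ W) :
    FEt.homToOver (f ≫ g) = FEt.homToOver f ≫ FEt.homToOver g := rfl

/-- The topology on `FEt k` whose coverings are the jointly surjective families. -/
def FEt.topology (k : Type u) [Field k] : GrothendieckTopology (FEt k) where
  sieves U := {R | ∀ x : U.toOver.left, ∃ (V : FEt k) (f : V ⟶ U) (y : V.toOver.left),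
    R f ∧ (FEt.homToOver f).left y = x}
  top_mem' U x := ⟨U, 𝟙 U, x, trivial, rfl⟩
  pullback_stable' := by
    intro U W R g hR x
    obtain ⟨V, f, y, hf, hy⟩ := hR ((FEt.homToOver g).left x)
    obtain ⟨z, -, hz⟩ := Scheme.Pullback.exists_preimage_pullback
      (f := (FEt.homToOver f).left) (g := (FEt.homToOver g).left) y x hy
    have w : (FEt.homToOver f).left ≫ U.toOver.hom = V.toOver.hom := Over.w (FEt.homToOver f)
    have := U.isFinite
    have := U.etale
    have := W.isFinite
    have := W.etale
    have : IsFinite ((FEt.homToOver f).left ≫ U.toOver.hom) := w ▸ V.isFinite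
    have : Etale ((FEt.homToOver f).left ≫ U.toOver.hom) := w ▸ V.etale
    have : IsFinite (FEt.homToOver f).left := IsFinite.of_comp _ U.toOver.hom
    have : Etale (FEt.homToOver f).left := Etale.of_comp _ U.toOver.hom
    let P : FEt k :=
      ⟨Over.mk (pullback.snd (FEt.homToOver f).left (FEt.homToOver g).left ≫ W.toOver.hom),
        inferInstanceAs (IsFinite (_ ≫ _)), inferInstanceAs (Etale (_ ≫ _))⟩
    let q : P ⟶ W := Over.homMk (U := P.toOver) (V := W.toOver) (pullback.snd _ _) rfl
    let r : P ⟶ V := Over.homMk (U := P.toOver) (V := V.toOver) (pullback.fst _ _) (by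
      simp only [P, Over.mk_hom, ← w, ← Over.w (FEt.homToOver g)]
      exact pullback.condition_assoc _)
    have hqr : q ≫ g = r ≫ f := by
      apply Over.OverMorphism.ext
      exact pullback.condition.symm
    refine ⟨P, q, z, ?_, hz⟩
    change R (q ≫ g)
    rw [hqr]
    exact R.downward_closed hf r
  transitive' := by
    intro U R hR R' h x
    obtain ⟨V, f, y, hf, rfl⟩ := hR x
    obtain ⟨W, g, z, hg, rfl⟩ := h hf y
    exact ⟨W, g ≫ f, z, hg, rfl⟩

/-! ### Varieties, covers of curves, and families of them -/

/-- Smooth projective curves `T ⟶ S` with geometrically integral fibers. Over a field, a curve is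
projective if and only if it is proper. If `S` is the spectrum of an algebraically closed field,
geometrically integral means integral. -/
structure IsSmoothProjectiveCurve {T S : Scheme.{u}} (π : T ⟶ S) : Prop where
  smooth : Smooth π
  proper : IsProper π
  geometricallyIntegral : GeometricallyIntegral π
  dimension_one (s : S) : topologicalKrullDim (π ⁻¹' {s} : Set T) = 1

/-- A variety over a field is a separated scheme of finite type. -/
structure IsVariety {T S : Scheme.{u}} (π : T ⟶ S) : Prop where
  separated : IsSeparated π
  locallyOfFiniteType : LocallyOfFiniteType π
  quasiCompact : QuasiCompact π

/-- The two kinds of objects: varieties, and covers of a smooth projective geometrically integral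
curve `C` over `k`. -/
inductive Kind (k : Type u) [Field k] : Type (u + 1)
  | variety : Kind k
  | cover (C : Over (Spec (.of k))) (hC : IsSmoothProjectiveCurve C.hom) : Kind k

/-- The `k`-scheme to which everything maps: `Spec k` for varieties, the curve `C` for covers
of `C`. -/
def Kind.base {k : Type u} [Field k] : Kind k → Over (Spec (.of k))
  | .variety => Over.mk (𝟙 _)
  | .cover C _ => C

/-- A scheme `T ⟶ S` together with an `S`-morphism `T ⟶ B ×_k S`, where `B` is the base of the
kind; the latter is given by its component `φ : T ⟶ B`. For varieties `B = Spec k`, and `φ` is no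
additional datum. -/
structure Family {k : Type u} [Field k] (κ : Kind k) (S : Over (Spec (.of k))) where
  T : Scheme.{u}
  π : T ⟶ S.left
  φ : T ⟶ κ.base.left
  w : φ ≫ κ.base.hom = π ≫ S.hom

/-- The `S`-morphism `T ⟶ B ×_k S`. -/
def Family.toProd {k : Type u} [Field k] {κ : Kind k} {S : Over (Spec (.of k))}
    (T : Family κ S) : T.T ⟶ pullback κ.base.hom S.hom :=
  pullback.lift T.φ T.π T.w

/-- `T ⟶ S` is a variety, respectively `T ⟶ C ×_k S` is a cover of curves: `T ⟶ S` is a smooth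
projective geometrically integral curve, and `T ⟶ C ×_k S` is not constant. This is used when `S` is
the spectrum of a field or a finite disjoint union of such spectra, where it is meant for each
component (the conditions are local on `S`). -/
def Family.IsAdmissible {k : Type u} [Field k] {κ : Kind k} {S : Over (Spec (.of k))}
    (T : Family κ S) : Prop :=
  match κ with
  | .variety => IsVariety T.π
  | .cover _ _ => IsSmoothProjectiveCurve T.π ∧
      ∀ s : S.left, ¬ (T.toProd '' (T.π ⁻¹' {s} : Set T.T)).Subsingleton

/-- Cartesian squares
```
  T ----> T'
  |       |
  S --f-> S'
```
compatible with the morphisms to the base of the kind. -/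
@[ext]
structure Family.CartHom {k : Type u} [Field k] {κ : Kind k} {S S' : Over (Spec (.of k))}
    (T : Family κ S) (T' : Family κ S') (f : S ⟶ S') where
  top : T.T ⟶ T'.T
  isPullback : IsPullback top T.π T'.π f.left
  top_φ : top ≫ T'.φ = T.φ

/-- The spectrum of a `k`-algebra, as a `k`-scheme. -/
def specOver (k : Type u) [Field k] (A : Type u) [CommRing A] [Algebra k A] :
    Over (Spec (.of k)) :=
  Over.mk (Spec.map (CommRingCat.ofHom (algebraMap k A)))

/-- `Spec (e) : Spec B ⟶ Spec A`, for a morphism `e : A → B` of `k`-algebras. -/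
def specOverMap {k : Type u} [Field k] {A B : Type u} [CommRing A] [Algebra k A] [CommRing B]
    [Algebra k B] (e : A →ₐ[k] B) : specOver k B ⟶ specOver k A :=
  Over.homMk (Spec.map (CommRingCat.ofHom e.toRingHom)) (by
    simp only [specOver, Over.mk_hom, ← Spec.map_comp, ← CommRingCat.ofHom_comp]
    congr 2
    exact e.comp_algebraMap)

/-- A variety over `K`, or a cover of curves `Y ⟶ C ×_k K`. -/
structure DescentObject (k K : Type u) [Field k] [Field K] [Algebra k K] where
  kind : Kind k
  toFamily : Family kind (specOver k K)
  isAdmissible : toFamily.IsAdmissible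

namespace DescentObject

variable {k K : Type u} [Field k] [Field K] [Algebra k K]

/-- `k` is the field of moduli of `X`: every `Spec σ`, for `σ` a `k`-automorphism of `K`, lifts to
an automorphism of the `k`-scheme `X` (compatible with `X ⟶ C`, for covers of `C`); that is, `X` is
isomorphic to all its conjugates. -/
def HasFieldOfModuli (X : DescentObject k K) : Prop :=
  ∀ σ : K ≃ₐ[k] K,
    Nonempty (X.toFamily.CartHom X.toFamily (specOverMap (σ : K →ₐ[k] K)))

/-- `X` has a model over `l`, for the embedding `e` of `l` in `K`. -/
def HasModelAlong (X : DescentObject k K) {l : Type u} [Field l] [Algebra k l]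
    (e : l →ₐ[k] K) : Prop :=
  ∃ T : Family X.kind (specOver k l),
    T.IsAdmissible ∧ Nonempty (X.toFamily.CartHom T (specOverMap e))

/-- The subfield `l` of `K` is a field of definition of `X`: there is a model of `X` over `l`, for
the inclusion of `l` in `K`. -/
def IsFieldOfDefinition (X : DescentObject k K) (l : IntermediateField k K) : Prop :=
  X.HasModelAlong l.val

/-- There is a "model" of `X` over `l`: a model for some `k`-embedding of `l` in `K`. -/
def HasModelOver (X : DescentObject k K) (l : IntermediateField k K) : Prop :=
  ∃ e : l →ₐ[k] K, X.HasModelAlong e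

/-- There is a descent obstruction: `k` is the field of moduli, but not a field of definition. -/
def HasDescentObstruction (X : DescentObject k K) : Prop :=
  X.HasFieldOfModuli ∧ ¬ X.IsFieldOfDefinition ⊥

/-- The "models" of `X` over finite étale `k`-schemes `U`: families over `U` which over every
connected component of `U`, that is, at every point `u` of `U`, become isomorphic to `X` after
pullback along some `k`-morphism `Spec K ⟶ U` with image `u`. -/
structure Model (X : DescentObject k K) where
  U : FEt k
  family : Family X.kind U.toOver
  isAdmissible : family.IsAdmissible
  exists_geometricPoint (u : U.toOver.left) :
    ∃ g : specOver k K ⟶ U.toOver, u ∈ Set.range g.left ∧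
      Nonempty (X.toFamily.CartHom family g)

/-- Morphisms of "models": cartesian squares over `Spec k`. -/
@[ext]
structure Model.Hom {X : DescentObject k K} (M N : X.Model) where
  base : M.U ⟶ N.U
  top : M.family.T ⟶ N.family.T
  isPullback : IsPullback top M.family.π N.family.π (FEt.homToOver base).left
  top_φ : top ≫ N.family.φ = M.family.φ

instance (X : DescentObject k K) : Category.{u} X.Model where
  Hom M N := Model.Hom M N
  id M := ⟨𝟙 _, 𝟙 _, IsPullback.id_horiz _, by simp⟩
  comp f g := ⟨f.base ≫ g.base, f.top ≫ g.top, f.isPullback.paste_horiz g.isPullback,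
    by simp [f.top_φ, g.top_φ]⟩
  id_comp f := by apply Model.Hom.ext <;> simp
  comp_id f := by apply Model.Hom.ext <;> simp
  assoc f g h := by apply Model.Hom.ext <;> simp

/-- The functor that sends a "model" over `U` to `U`. -/
def proj (X : DescentObject k K) : X.Model ⥤ FEt k where
  obj M := M.U
  map f := Model.Hom.base f

/-- The category of "models" of `X`, over the category of finite étale `k`-schemes. -/
abbrev models (X : DescentObject k K) : BasedCategory.{u, u + 1} (FEt k) where
  obj := X.Model
  p := X.proj

end DescentObject

end

/-!
Any two forms of `X` over finite extensions of `k` become isomorphic over a common finite extension,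
compatibly with their embeddings in `K`. So a conjugate `X^σ` is isomorphic to `X` as soon as two
restrictions of one form over a finite extension are, and a functor between categories of "models"
transports this from `X` to `Y`. If `k` is the field of moduli of `X`, then a model along one
embedding of `l` can be moved to every other embedding, since these are conjugate.

Conversely, let `F` be fully faithful, and let `y` be a form of `Y` over `l`. Over a finite Galois
extension `L` of `l`, the form `y` becomes the image of a form `T` of `X`, and because `F` is fully
faithful the descent datum of `y` along `Spec L ⟶ Spec l` lifts to `T`. For varieties it is
effective by hypothesis. A cover of curves is finite over `C ×_k L`, so the quotient by the Galois
action can be formed on invariant affine open subschemes, by Galois descent of rings.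

The argument for gerbes is the same: an object of `𝒴` is locally in the image of `F`, and the local
preimages inherit a descent datum.
-/

noncomputable section

/-! ### Descent along fully faithful cartesian functors -/

namespace FibStack

variable {𝒮 : Type u₁} [Category.{v₁} 𝒮]

section CartesianCocone

variable {𝒳 : Type u₂} [Category.{v₂} 𝒳] {p : 𝒳 ⥤ 𝒮} {U : 𝒮} {R : Sieve U}

/-- A compatible family of cartesian arrows from the objects of a descent datum to an object `x`.
It exhibits the descent datum as the system of restrictions of `x`; a descent datum is effective if
it has a cartesian cocone with vertex over `U`. -/
structure DescentDatum.CartesianCocone (D : DescentDatum p R) (x : 𝒳) where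
  arrow {V : 𝒮} (f : V ⟶ U) (hf : R f) : D.obj f hf ⟶ x
  isStronglyCartesian_arrow {V : 𝒮} (f : V ⟶ U) (hf : R f) :
    p.IsStronglyCartesian f (arrow f hf)
  map_comp_arrow {W V : 𝒮} (e : W ⟶ U) (he : R e) (f : V ⟶ U) (hf : R f) (g : W ⟶ V)
    (w : g ≫ f = e) : D.map e he f hf g w ≫ arrow f hf = arrow e he

attribute [instance] DescentDatum.isStronglyCartesian_map
  DescentDatum.CartesianCocone.isStronglyCartesian_arrow

lemma DescentDatum.IsEffective.exists_cartesianCocone {D : DescentDatum p R} (h : D.IsEffective) :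
    ∃ x : 𝒳, p.obj x = U ∧ Nonempty (D.CartesianCocone x) := by
  obtain ⟨x, c, hx, hc, hDc⟩ := h
  exact ⟨x, hx, ⟨⟨c, hc, hDc⟩⟩⟩

/-- The system of the restrictions of a morphism over `𝟙 U`. -/
def LocalHom.ofHom {a b : 𝒳} (χ : a ⟶ b) [p.IsHomLift (𝟙 U) χ] : LocalHom p R a b where
  app _ _ _ c _ := c ≫ χ
  isHomLift_app _ _ _ _ _ := inferInstance
  comp_app _ _ _ _ _ _ _ _ _ _ _ _ _ _ hdc := by rw [← Category.assoc, hdc]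

/-- Two objects with cartesian cocones over the same descent datum are locally isomorphic: on the
restrictions to the arrows of `R`, this is the composite `f^*a ≅ D_f ≅ f^*b`. -/
def DescentDatum.CartesianCocone.localHom {D : DescentDatum p R} {a b : 𝒳}
    (A : D.CartesianCocone a) (B : D.CartesianCocone b) : LocalHom p R a b where
  app f hf _ c _ := IsCartesian.map p f (A.arrow f hf) c ≫ B.arrow f hf
  isHomLift_app _ _ _ _ _ := inferInstance
  comp_app e he f hf g w _ _ _ _ _ _ _ _ hdc := by
    rw [← B.map_comp_arrow e he f hf g w, ← Category.assoc, ← Category.assoc]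
    congr 1
    apply IsStronglyCartesian.ext p f (A.arrow f hf) g
    rw [Category.assoc, Category.assoc, A.map_comp_arrow, IsCartesian.fac, IsCartesian.fac, hdc]

end CartesianCocone

variable {𝒳 : BasedCategory.{v₂, u₂} 𝒮} {𝒴 : BasedCategory.{v₃, u₃} 𝒮} {U : 𝒮} {R : Sieve U}

namespace IsStack

variable {J : GrothendieckTopology 𝒮} (h𝒳 : IsStack J 𝒳) (hR : R ∈ J U)
  {D : DescentDatum 𝒳.p R} {a b : 𝒳.obj} (ha : 𝒳.p.obj a = U) (hb : 𝒳.p.obj b = U)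

include h𝒳 hR ha hb

lemma exists_hom_of_cartesianCocone (A : D.CartesianCocone a) (B : D.CartesianCocone b) :
    ∃ χ : a ⟶ b, 𝒳.p.IsHomLift (𝟙 U) χ ∧
      ∀ {V : 𝒮} (f : V ⟶ U) (hf : R f), A.arrow f hf ≫ χ = B.arrow f hf := by
  obtain ⟨χ, ⟨hχ, hAχ⟩, -⟩ := h𝒳.existsUnique_glue R hR a b ha hb (A.localHom B)
  refine ⟨χ, hχ, fun f hf ↦ (hAχ f hf (A.arrow f hf) inferInstance).trans ?_⟩
  simp only [DescentDatum.CartesianCocone.localHom, IsCartesian.map_self, Category.id_comp]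

lemma hom_ext_of_cartesianCocone (A : D.CartesianCocone a) {χ χ' : a ⟶ b} [𝒳.p.IsHomLift (𝟙 U) χ]
    [𝒳.p.IsHomLift (𝟙 U) χ']
    (h : ∀ {V : 𝒮} (f : V ⟶ U) (hf : R f), A.arrow f hf ≫ χ = A.arrow f hf ≫ χ') : χ = χ' := by
  obtain ⟨_, -, huniq⟩ := h𝒳.existsUnique_glue R hR a b ha hb (LocalHom.ofHom χ)
  rw [huniq χ ⟨inferInstance, fun _ _ _ _ _ ↦ rfl⟩]
  refine (huniq χ' ⟨inferInstance, fun f hf _ c _ ↦ ?_⟩).symm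
  change c ≫ χ' = c ≫ χ
  rw [← IsCartesian.fac 𝒳.p f (A.arrow f hf) c, Category.assoc, Category.assoc, h]

lemma exists_iso_of_cartesianCocone (A : D.CartesianCocone a) (B : D.CartesianCocone b) :
    ∃ i : a ≅ b, 𝒳.p.IsHomLift (𝟙 U) i.hom := by
  obtain ⟨χ, hχ, hAχ⟩ := h𝒳.exists_hom_of_cartesianCocone hR ha hb A B
  obtain ⟨χ', hχ', hBχ'⟩ := h𝒳.exists_hom_of_cartesianCocone hR hb ha B A
  have hida : 𝒳.p.IsHomLift (𝟙 U) (𝟙 a) := IsHomLift.id ha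
  have hidb : 𝒳.p.IsHomLift (𝟙 U) (𝟙 b) := IsHomLift.id hb
  refine ⟨⟨χ, χ', ?_, ?_⟩, hχ⟩
  · apply h𝒳.hom_ext_of_cartesianCocone hR ha ha A
    intro V f hf
    rw [← Category.assoc, hAχ, hBχ', Category.comp_id]
  · apply h𝒳.hom_ext_of_cartesianCocone hR hb hb B
    intro V f hf
    rw [← Category.assoc, hBχ', hAχ, Category.comp_id]

end IsStack

/-- The image of a descent datum under a cartesian functor. -/
def DescentDatum.image (D : DescentDatum 𝒳.p R) {F : BasedFunctor 𝒳 𝒴}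
    (hF : IsCartesianFunctor F) : DescentDatum 𝒴.p R where
  obj f hf := F.obj (D.obj f hf)
  map e he f hf g w := F.map (D.map e he f hf g w)
  isStronglyCartesian_map _ _ _ _ g _ := hF g _ inferInstance
  map_id f hf := by rw [D.map_id, F.toFunctor.map_id]
  map_comp d hd e he f hf h g w w' := by rw [← F.toFunctor.map_comp, D.map_comp]

/-- The image of a cartesian cocone under a cartesian functor. -/
def DescentDatum.CartesianCocone.image {D : DescentDatum 𝒳.p R} {x : 𝒳.obj}
    (A : D.CartesianCocone x) {F : BasedFunctor 𝒳 𝒴} (hF : IsCartesianFunctor F) :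
    (D.image hF).CartesianCocone (F.obj x) where
  arrow f hf := F.map (A.arrow f hf)
  isStronglyCartesian_arrow f _ := hF f _ inferInstance
  map_comp_arrow e he f hf g w := by
    rw [← A.map_comp_arrow e he f hf g w, F.toFunctor.map_comp]
    rfl

section FullyFaithful

variable (F : BasedFunctor 𝒳 𝒴) [F.toFunctor.Full] [F.toFunctor.Faithful]

lemma existsUnique_isHomLift_map_comp_eq {V W : 𝒮} (f : V ⟶ U) {a b : 𝒳.obj} {y : 𝒴.obj}
    (j : F.obj b ⟶ y) [𝒴.p.IsStronglyCartesian f j] (g : W ⟶ V) (j' : F.obj a ⟶ y)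
    [𝒴.p.IsHomLift (g ≫ f) j'] :
    ∃! χ : a ⟶ b, 𝒳.p.IsHomLift g χ ∧ F.map χ ≫ j = j' := by
  obtain ⟨χ, ⟨hχ, hχj⟩, huniq⟩ :=
    IsStronglyCartesian.universal_property 𝒴.p f j g (g ≫ f) rfl j'
  obtain ⟨χ, rfl⟩ := F.toFunctor.map_surjective χ
  refine ⟨χ, ⟨F.isHomLift_map g χ, hχj⟩, ?_⟩
  rintro χ' ⟨_, hχ'j⟩
  exact F.toFunctor.map_injective (huniq _ ⟨inferInstance, hχ'j⟩)

lemma isStronglyCartesian_of_isStronglyCartesian_map {V : 𝒮} (f : V ⟶ U) {a b : 𝒳.obj} (c : a ⟶ b)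
    [𝒴.p.IsStronglyCartesian f (F.map c)] : 𝒳.p.IsStronglyCartesian f c := by
  have : 𝒳.p.IsHomLift f c := F.isHomLift_map f c
  refine ⟨fun g φ _ ↦ ?_⟩
  simpa only [← F.toFunctor.map_comp, F.toFunctor.map_injective.eq_iff] using
    existsUnique_isHomLift_map_comp_eq F f (F.map c) g (F.map φ)

lemma exists_action_isHomLift {G : Type*} [MulOneClass G] {V : 𝒮} (f : V ⟶ U) {x : 𝒳.obj}
    {y : 𝒴.obj} (j : F.obj x ⟶ y) [𝒴.p.IsStronglyCartesian f j] (b : G → (V ⟶ V))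
    (hb : ∀ σ, b σ ≫ f = f) (hb_one : b 1 = 𝟙 V) (hb_mul : ∀ σ τ, b (σ * τ) = b σ ≫ b τ) :
    ∃ s : G → (x ⟶ x), (∀ σ, 𝒳.p.IsHomLift (b σ) (s σ)) ∧ s 1 = 𝟙 x ∧
      ∀ σ τ, s (σ * τ) = s σ ≫ s τ := by
  have hj (σ) : 𝒴.p.IsHomLift (b σ ≫ f) j := by
    rw [hb]
    infer_instance
  choose s hs huniq using fun σ ↦ existsUnique_isHomLift_map_comp_eq F f j (b σ) j
  dsimp only at hs huniq
  have hx : 𝒳.p.obj x = V := (F.w_obj x).symm.trans (IsHomLift.domain_eq 𝒴.p f j)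
  refine ⟨s, fun σ ↦ (hs σ).1, (huniq 1 _ ⟨?_, ?_⟩).symm, fun σ τ ↦ (huniq _ _ ⟨?_, ?_⟩).symm⟩
  · rw [hb_one]
    exact IsHomLift.id hx
  · rw [F.toFunctor.map_id, Category.id_comp]
  · have := (hs σ).1
    have := (hs τ).1
    rw [hb_mul]
    infer_instance
  · rw [F.toFunctor.map_comp, Category.assoc, (hs τ).2, (hs σ).2]

/-- The descent datum formed by local lifts along a fully faithful functor of the restrictions of an
object `y`. -/
def descentDatumOfLifts (R : Sieve U) (y : 𝒴.obj) (x : ∀ {V : 𝒮} (f : V ⟶ U), R f → 𝒳.obj)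
    (j : ∀ {V : 𝒮} (f : V ⟶ U) (hf : R f), F.obj (x f hf) ⟶ y)
    [hj : ∀ {V : 𝒮} (f : V ⟶ U) (hf : R f), 𝒴.p.IsStronglyCartesian f (j f hf)] :
    DescentDatum 𝒳.p R where
  obj f hf := x f hf
  map e he f hf g w :=
    F.toFunctor.preimage (IsStronglyCartesian.map 𝒴.p f (j f hf) w.symm (j e he))
  isStronglyCartesian_map e he f hf g w := by
    have : 𝒴.p.IsStronglyCartesian (g ≫ f)
        (IsStronglyCartesian.map 𝒴.p f (j f hf) w.symm (j e he) ≫ j f hf) := by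
      rw [IsStronglyCartesian.fac, w]
      exact hj e he
    have : 𝒴.p.IsStronglyCartesian g (F.map
        (F.toFunctor.preimage (IsStronglyCartesian.map 𝒴.p f (j f hf) w.symm (j e he)))) := by
      rw [F.toFunctor.map_preimage]
      exact IsStronglyCartesian.of_comp 𝒴.p (g := f) (ψ := j f hf)
    exact isStronglyCartesian_of_isStronglyCartesian_map F g _
  map_id f hf := by
    apply F.toFunctor.map_injective
    rw [F.toFunctor.map_preimage, F.toFunctor.map_id]
    exact IsStronglyCartesian.map_self 𝒴.p f (j f hf)
  map_comp d hd e he f hf h g w w' := by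
    apply F.toFunctor.map_injective
    simp only [F.toFunctor.map_comp, F.toFunctor.map_preimage]
    exact IsStronglyCartesian.map_comp_map ..

lemma exists_descentDatum_image_cartesianCocone (hF : IsCartesianFunctor F) (R : Sieve U)
    (y : 𝒴.obj) (h : ∀ {V : 𝒮} (f : V ⟶ U), R f →
      ∃ (x : 𝒳.obj) (j : F.obj x ⟶ y), 𝒴.p.IsStronglyCartesian f j) :
    ∃ D : DescentDatum 𝒳.p R, Nonempty ((D.image hF).CartesianCocone y) := by
  choose x j hj using @h
  have := @hj
  refine ⟨descentDatumOfLifts F R y x j, ⟨j, hj, fun e he f hf g w ↦ ?_⟩⟩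
  simp only [DescentDatum.image, descentDatumOfLifts, F.toFunctor.map_preimage]
  exact IsStronglyCartesian.fac ..

end FullyFaithful

/-- Every object of the site has a covering whose members carry objects of `𝒳`. -/
def IsLocallyNonempty (J : GrothendieckTopology 𝒮) (𝒳 : BasedCategory.{v₂, u₂} 𝒮) : Prop :=
  ∀ U : 𝒮, ∃ R ∈ J U, ∀ {V : 𝒮} (f : V ⟶ U), R f → Nonempty (𝒳.p.Fiber V)

/-- Any two objects of `𝒳` over the same object of the site are locally isomorphic. As in `IsGerbe`,
the isomorphism is recorded as a common pullback `z`. -/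
def IsLocallyConnected (J : GrothendieckTopology 𝒮) (𝒳 : BasedCategory.{v₂, u₂} 𝒮) : Prop :=
  ∀ {U : 𝒮} (x y : 𝒳.obj), 𝒳.p.obj x = U → 𝒳.p.obj y = U →
    ∃ R ∈ J U, ∀ {V : 𝒮} (f : V ⟶ U), R f →
      ∃ (z : 𝒳.obj) (a : z ⟶ x) (b : z ⟶ y),
        𝒳.p.IsStronglyCartesian f a ∧ 𝒳.p.IsStronglyCartesian f b

/-- The sieve of the arrows `f : V ⟶ U` such that the restriction of `y` to `V` is in the
essential image of `F`. -/
def liftSieve [𝒳.p.IsFibered] {F : BasedFunctor 𝒳 𝒴} (hF : IsCartesianFunctor F) (U : 𝒮)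
    (y : 𝒴.obj) : Sieve U where
  arrows V f := ∃ (x : 𝒳.obj) (j : F.obj x ⟶ y), 𝒴.p.IsStronglyCartesian f j
  downward_closed := by
    rintro V W f ⟨x, j, _⟩ g
    have hx : 𝒳.p.obj x = V := (F.w_obj x).symm.trans (IsHomLift.domain_eq 𝒴.p f j)
    obtain ⟨x', c, _⟩ := IsPreFibered.exists_isCartesian 𝒳.p hx g
    have := hF g c inferInstance
    exact ⟨x', F.map c ≫ j, inferInstance⟩

section Stack

variable {J : GrothendieckTopology 𝒮} {F : BasedFunctor 𝒳 𝒴}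

lemma liftSieve_mem [𝒳.p.IsFibered] [𝒴.p.IsFibered] (hF : IsCartesianFunctor F)
    (hne : IsLocallyNonempty J 𝒳) (hconn : IsLocallyConnected J 𝒴)
    {y : 𝒴.obj} (hy : 𝒴.p.obj y = U) : liftSieve hF U y ∈ J U := by
  obtain ⟨R, hR, hRne⟩ := hne U
  refine J.transitive hR _ fun V f hf ↦ ?_
  obtain ⟨x, hx⟩ := hRne f hf
  obtain ⟨y', c, _⟩ := IsPreFibered.exists_isCartesian 𝒴.p hy f
  obtain ⟨R', hR', hconn'⟩ :=
    hconn (F.obj x) y' ((F.w_obj x).trans hx) (IsHomLift.domain_eq 𝒴.p f c)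
  refine J.superset_covering (fun W g hg ↦ ?_) hR'
  obtain ⟨z, a, b, _, _⟩ := hconn' g hg
  obtain ⟨x', d, _⟩ := IsPreFibered.exists_isCartesian 𝒳.p hx g
  have := hF g d inferInstance
  let i : F.obj x' ≅ z := IsCartesian.domainUniqueUpToIso 𝒴.p g a (F.map d)
  have : 𝒴.p.IsStronglyCartesian (𝟙 W) i.hom := inferInstance
  have : 𝒴.p.IsStronglyCartesian (𝟙 W ≫ g ≫ f) (i.hom ≫ b ≫ c) := inferInstance
  exact ⟨x', i.hom ≫ b ≫ c, by rwa [Category.id_comp] at this⟩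

theorem IsStack.exists_iso_of_liftSieve_mem (h𝒳 : IsStack J 𝒳) (h𝒴 : IsStack J 𝒴)
    [𝒳.p.IsFibered] (hF : IsCartesianFunctor F) [F.toFunctor.Full] [F.toFunctor.Faithful]
    {y : 𝒴.obj} (hy : 𝒴.p.obj y = U) (hR : liftSieve hF U y ∈ J U) :
    ∃ (x : 𝒳.obj) (i : F.obj x ≅ y), 𝒳.p.obj x = U ∧ 𝒴.p.IsHomLift (𝟙 U) i.hom := by
  obtain ⟨D, ⟨B⟩⟩ :=
    exists_descentDatum_image_cartesianCocone F hF (liftSieve hF U y) y fun _ hf ↦ hf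
  obtain ⟨x, hx, ⟨A⟩⟩ := (h𝒳.isEffective _ hR D).exists_cartesianCocone
  obtain ⟨i, hi⟩ :=
    h𝒴.exists_iso_of_cartesianCocone hR ((F.w_obj x).trans hx) hy (A.image hF) B
  exact ⟨x, i, hx, hi⟩

theorem IsStack.isFiberwiseEssSurj (h𝒳 : IsStack J 𝒳) (h𝒴 : IsStack J 𝒴)
    (hF : IsCartesianFunctor F) [F.toFunctor.Full] [F.toFunctor.Faithful]
    (hne : IsLocallyNonempty J 𝒳) (hconn : IsLocallyConnected J 𝒴) :
    IsFiberwiseEssSurj F := by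
  intro U y hy
  have := h𝒳.isFibered
  have := h𝒴.isFibered
  exact h𝒳.exists_iso_of_liftSieve_mem h𝒴 hF hy (liftSieve_mem hF hne hconn hy)

end Stack

end FibStack

/-! ### Cartesian squares of families -/

namespace Family

variable {k : Type u} [Field k] {κ : Kind k} {S S' S'' : Over (Spec (.of k))}

/-- Composition of cartesian squares of families. -/
def CartHom.comp {T : Family κ S} {T' : Family κ S'} {T'' : Family κ S''} {f : S ⟶ S'}
    {g : S' ⟶ S''} (a : T.CartHom T' f) (b : T'.CartHom T'' g) : T.CartHom T'' (f ≫ g) where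
  top := a.top ≫ b.top
  isPullback := by simpa using a.isPullback.paste_horiz b.isPullback
  top_φ := by rw [Category.assoc, b.top_φ, a.top_φ]

/-- The factorization of a cartesian square over `f ≫ g` through a cartesian square over `g`. -/
def CartHom.lift {T : Family κ S} {T' : Family κ S'} {T'' : Family κ S''} {f : S ⟶ S'}
    {g : S' ⟶ S''} {h : S ⟶ S''} (a : T.CartHom T'' h) (b : T'.CartHom T'' g) (w : f ≫ g = h) :
    T.CartHom T' f where
  top := b.isPullback.lift a.top (T.π ≫ f.left) (by
    rw [a.isPullback.w, ← w, Category.assoc, Over.comp_left])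
  isPullback := by
    refine IsPullback.of_right ?_ (b.isPullback.lift_snd ..) b.isPullback
    rw [b.isPullback.lift_fst]
    simpa [← w] using a.isPullback
  top_φ := by rw [← b.top_φ, b.isPullback.lift_fst_assoc, a.top_φ]

@[simp]
lemma CartHom.lift_top_comp_top {T : Family κ S} {T' : Family κ S'} {T'' : Family κ S''}
    {f : S ⟶ S'} {g : S' ⟶ S''} {h : S ⟶ S''} (a : T.CartHom T'' h) (b : T'.CartHom T'' g)
    (w : f ≫ g = h) : (a.lift b w).top ≫ b.top = a.top :=
  b.isPullback.lift_fst ..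

/-- The same cartesian square, over an equal morphism of bases. -/
def CartHom.cast {T : Family κ S} {T' : Family κ S'} {f g : S ⟶ S'} (a : T.CartHom T' f)
    (h : f = g) : T.CartHom T' g :=
  h ▸ a

/-- The base change of a family along a morphism of bases. -/
def baseChange (T : Family κ S') (f : S ⟶ S') : Family κ S where
  T := pullback T.π f.left
  π := pullback.snd _ _
  φ := pullback.fst _ _ ≫ T.φ
  w := by rw [Category.assoc, T.w, pullback.condition_assoc, Over.w f]

/-- The cartesian square that exhibits a base change. -/
def baseChangeHom (T : Family κ S') (f : S ⟶ S') : (T.baseChange f).CartHom T f where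
  top := pullback.fst _ _
  isPullback := IsPullback.of_hasPullback _ _
  top_φ := rfl

lemma toProd_fst (T : Family κ S) : T.toProd ≫ pullback.fst _ _ = T.φ :=
  pullback.lift_fst _ _ _

lemma toProd_snd (T : Family κ S) : T.toProd ≫ pullback.snd _ _ = T.π :=
  pullback.lift_snd _ _ _

end Family

/-! ### Integral morphisms and dimension -/

lemma height_apply_le_height {α β : Type*} [PartialOrder α] [Preorder β] {f : α → β}
    (hlift : ∀ a, ∀ b ≤ f a, ∃ a' ≤ a, f a' = b) (a : α) :
    Order.height (f a) ≤ Order.height a := by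
  suffices h : ∀ (n : ℕ) (a : α), n ≤ Order.height (f a) → n ≤ Order.height a from
    ENat.forall_natCast_le_iff_le.mp fun n ↦ h n a
  intro n
  induction n with
  | zero => simp
  | succ n ih =>
    intro a hn
    obtain ⟨p, hlast, hlen⟩ := Order.exists_series_of_le_height (f a) hn
    obtain ⟨a', ha', hfa'⟩ := hlift a p.eraseLast.last (hlast ▸ p.monotone (Fin.le_last _))
    have hlt : f a' < f a := by
      rw [hfa', ← hlast]
      exact p.eraseLast_last_rel_last (by simp [hlen])
    have hne : a' ≠ a := fun h ↦ hlt.ne (congrArg f h)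
    have hn' : (n : ℕ∞) ≤ Order.height a' := by
      refine ih a' ?_
      rw [hfa']
      simpa [hlen] using Order.length_le_height_last (p := p.eraseLast)
    push_cast
    exact (add_le_add_left hn' 1).trans (Order.height_add_one_le (ha'.lt_of_ne hne))

lemma topologicalKrullDim_eq_of_specializingMap {X Y : Type*} [TopologicalSpace X]
    [TopologicalSpace Y] [QuasiSober X] [T0Space X] [QuasiSober Y] [T0Space Y] {f : X → Y}
    (hc : Continuous f) (hs : SpecializingMap f) (hsurj : Function.Surjective f)
    (hinc : ∀ x x', x ⤳ x' → f x = f x' → x = x') :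
    topologicalKrullDim X = topologicalKrullDim Y := by
  let : PartialOrder X := specializationOrder X
  let : PartialOrder Y := specializationOrder Y
  have hX : topologicalKrullDim X = Order.krullDim X :=
    Order.krullDim_eq_of_orderIso irreducibleSetEquivPoints
  have hY : topologicalKrullDim Y = Order.krullDim Y :=
    Order.krullDim_eq_of_orderIso irreducibleSetEquivPoints
  rw [hX, hY]
  refine le_antisymm (Order.krullDim_le_of_strictMono f fun x x' h ↦ ?_) ?_
  · exact lt_of_le_of_ne (h.le.map hc) fun e ↦ h.ne' (hinc x' x h.le e.symm)
  · rw [Order.krullDim_eq_iSup_height, Order.krullDim_eq_iSup_height, iSup_le_iff]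
    intro y
    obtain ⟨x, rfl⟩ := hsurj y
    have hlift (x : X) (y : Y) (hy : y ≤ f x) : ∃ x' ≤ x, f x' = y := hs hy
    exact le_iSup_of_le x (WithBot.coe_le_coe.mpr (height_apply_le_height hlift x))

lemma t1Space_of_isIntegralHom {K : Type u} [Field K] {Z : Scheme.{u}} (g : Z ⟶ Spec (.of K))
    [IsIntegralHom g] : T1Space Z := by
  have : IsAffine Z := isAffine_of_isAffineHom g
  obtain ⟨φ, hφ⟩ := Spec.map_surjective (Z.isoSpec.inv ≫ g)
  have hint : IsIntegralHom (Spec.map φ) := by rw [hφ]; infer_instance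
  rw [IsIntegralHom.SpecMap_iff] at hint
  have hclosed (p : PrimeSpectrum Γ(Z, ⊤)) : IsClosed {p} := by
    rw [PrimeSpectrum.isClosed_singleton_iff_isMaximal]
    refine Ideal.isMaximal_of_isIntegral_of_isMaximal_comap' φ.hom hint _ ?_
    have hprime : (p.asIdeal.comap φ.hom).IsPrime := Ideal.comap_isPrime _ _
    rw [(Ideal.eq_bot_or_top (p.asIdeal.comap φ.hom)).resolve_right hprime.ne_top]
    exact Ideal.bot_isMaximal
  have : T1Space (PrimeSpectrum Γ(Z, ⊤)) := ⟨hclosed⟩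
  have hemb : Topology.IsEmbedding (Y := PrimeSpectrum Γ(Z, ⊤)) Z.isoSpec.hom :=
    Z.isoSpec.hom.homeomorph.isEmbedding
  exact hemb.t1Space

lemma eq_of_specializes_of_isIntegralHom {X Y : Scheme.{u}} (g : X ⟶ Y) [IsIntegralHom g]
    {x x' : X} (h : x ⤳ x') (e : g x = g x') : x = x' := by
  let q : g.fiber (g x') ⟶ Spec (.of (Y.residueField (g x'))) := g.fiberToSpecResidueField (g x')
  have : IsIntegralHom q := inferInstanceAs (IsIntegralHom (pullback.snd _ _))
  have : T1Space (g.fiber (g x')) := t1Space_of_isIntegralHom q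
  have : T1Space (g ⁻¹' {g x'}) := (g.fiberHomeo (g x')).symm.isEmbedding.t1Space
  have hfiber : (⟨x, e⟩ : g ⁻¹' {g x'}) ⤳ ⟨x', rfl⟩ :=
    Topology.IsInducing.subtypeVal.specializes_iff.mp h
  exact congrArg Subtype.val hfiber.eq

lemma topologicalKrullDim_eq_of_isIntegralHom {X Y : Scheme.{u}} (g : X ⟶ Y) [IsIntegralHom g]
    [Surjective g] : topologicalKrullDim X = topologicalKrullDim Y :=
  topologicalKrullDim_eq_of_specializingMap g.continuous g.isClosedMap.specializingMap g.surjective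
    fun _ _ ↦ eq_of_specializes_of_isIntegralHom g

/-! ### Faithfully flat descent -/

lemma isReduced_of_flat_of_surjective {X Y : Scheme.{u}} (f : X ⟶ Y) [Flat f] [Surjective f]
    [IsReduced X] : IsReduced Y := by
  have (y : Y) : _root_.IsReduced (Y.presheaf.stalk y) := by
    obtain ⟨x, rfl⟩ := f.surjective y
    refine isReduced_of_injective (f.stalkMap x).hom ?_
    algebraize [(f.stalkMap x).hom]
    have : Module.Flat (Y.presheaf.stalk (f x)) (X.presheaf.stalk x) := Flat.stalkMap f x
    have : IsLocalHom (algebraMap (Y.presheaf.stalk (f x)) (X.presheaf.stalk x)) :=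
      f.toLRSHom.prop x
    have : Module.FaithfullyFlat (Y.presheaf.stalk (f x)) (X.presheaf.stalk x) :=
      Module.FaithfullyFlat.of_flat_of_isLocalHom
    exact FaithfulSMul.algebraMap_injective _ _
  exact isReduced_of_isReduced_stalk Y

lemma irreducibleSpace_of_surjective {X Y : Type*} [TopologicalSpace X] [TopologicalSpace Y]
    [IrreducibleSpace X] {f : X → Y} (hf : Continuous f) (hs : Function.Surjective f) :
    IrreducibleSpace Y := by
  have : IsIrreducible (Set.univ : Set Y) := by
    rw [← hs.range_eq, ← Set.image_univ]
    exact (IrreducibleSpace.isIrreducible_univ X).image f hf.continuousOn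
  exact (irreducibleSpace_def Y).mpr this

lemma isIntegral_of_flat_of_surjective {X Y : Scheme.{u}} (f : X ⟶ Y) [Flat f] [Surjective f]
    [IsIntegral X] : IsIntegral Y := by
  rw [isIntegral_iff_irreducibleSpace_and_isReduced]
  exact ⟨irreducibleSpace_of_surjective f.continuous f.surjective,
    isReduced_of_flat_of_surjective f⟩

/-- The faithfully flat quasi-compact morphisms, as a property of morphisms of schemes; written as
the intersection for which Mathlib's descent instances are stated. -/
abbrev fpqc : MorphismProperty Scheme.{u} := @Surjective ⊓ @Flat ⊓ @QuasiCompact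

instance : fpqc.{u}.IsStableUnderBaseChange where
  of_isPullback h hf :=
    ⟨⟨MorphismProperty.of_isPullback (P := @Surjective) h hf.1.1,
      MorphismProperty.of_isPullback (P := @Flat) h hf.1.2⟩,
      MorphismProperty.of_isPullback (P := @QuasiCompact) h hf.2⟩

lemma flat_and_surjective_of_field {E F : Type u} [Field E] [Field F]
    (r : Spec (.of F) ⟶ Spec (.of E)) : Flat r ∧ Surjective r := by
  obtain ⟨φ, rfl⟩ := Spec.map_surjective r
  rw [flat_and_surjective_SpecMap_iff]
  algebraize [φ.hom]
  exact inferInstanceAs (Module.FaithfullyFlat E F)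

lemma fpqc_of_field {E F : Type u} [Field E] [Field F] (r : Spec (.of F) ⟶ Spec (.of E)) :
    fpqc r :=
  ⟨(flat_and_surjective_of_field r).symm, inferInstance⟩

section descent

variable {T' T V U : Scheme.{u}} {g : T' ⟶ T} {π' : T' ⟶ V} {π : T ⟶ U} {v : V ⟶ U}

lemma isSeparated_of_isPullback_of_fpqc (h : IsPullback g π' π v) (hv : fpqc v)
    [IsSeparated π'] : IsSeparated π := by
  have : MorphismProperty.RespectsIso @UniversallyClosed :=
    MorphismProperty.IsStableUnderBaseChange.respectsIso
  have : MorphismProperty.DescendsAlong (.diagonal @UniversallyClosed) fpqc.{u} :=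
    MorphismProperty.instDescendsAlongDiagonalOfRespectsIsoOfIsStableUnderBaseChange _ _
  have hdiag' : (MorphismProperty.diagonal @UniversallyClosed) π' :=
    inferInstanceAs (UniversallyClosed (pullback.diagonal π'))
  have hdiag : UniversallyClosed (pullback.diagonal π) :=
    MorphismProperty.of_isPullback_of_descendsAlong (P := .diagonal @UniversallyClosed)
      (Q := fpqc) h.flip hv hdiag'
  exact ⟨.of_isPreimmersion _ (pullback.diagonal π).isClosedMap.isClosed_range⟩

lemma quasiCompact_of_isPullback_of_surjective [IsAffine U] [IsAffine V]
    (h : IsPullback g π' π v) [Surjective v] [QuasiCompact π'] : QuasiCompact π := by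
  have : Surjective g := MorphismProperty.of_isPullback h.flip ‹_›
  have : CompactSpace T' := (quasiCompact_iff_compactSpace π').mp ‹_›
  refine (quasiCompact_iff_compactSpace π).mpr ⟨?_⟩
  rw [← g.surjective.range_eq]
  exact isCompact_range g.continuous

lemma geometricallyIntegral_of_isPullback_of_surjective (h : IsPullback g π' π v) [Surjective v]
    [GeometricallyIntegral π'] : GeometricallyIntegral π := by
  refine ⟨fun E _ y Z fst snd hZ ↦ ?_⟩
  let P : Scheme.{u} := pullback v y
  obtain ⟨p⟩ : Nonempty P :=
    ⟨((pullback.snd v y).surjective (Classical.arbitrary _)).choose⟩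
  let q : Spec (P.residueField p) ⟶ P := P.fromSpecResidueField p
  let r : Spec (P.residueField p) ⟶ Spec (.of E) := q ≫ pullback.snd v y
  obtain ⟨_, _⟩ := flat_and_surjective_of_field r
  let m : pullback snd r ⟶ T' :=
    h.lift (pullback.fst _ _ ≫ fst) (pullback.snd _ _ ≫ q ≫ pullback.fst v y) (by
      simp only [Category.assoc]
      rw [hZ.w, pullback.condition (f := v), pullback.condition_assoc]
      simp [r])
  have hmg : IsPullback (m ≫ g) (pullback.snd snd r) π ((q ≫ pullback.fst v y) ≫ v) := by
    rw [h.lift_fst, Category.assoc, pullback.condition (f := v), ← Category.assoc]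
    exact (IsPullback.of_hasPullback snd r).paste_horiz hZ
  have : IsIntegral (pullback snd r) :=
    GeometricallyIntegral.geometrically_isIntegral (f := π') (K := P.residueField p)
      (q ≫ pullback.fst v y) m (pullback.snd _ _) (IsPullback.of_right hmg (h.lift_snd ..) h)
  exact isIntegral_of_flat_of_surjective (pullback.fst snd r)

end descent

/-! ### Admissible families and algebraic extensions of the base field -/

section field

variable {l : Type u} [Field l] {T : Scheme.{u}} {π : T ⟶ Spec (.of l)}

lemma preimage_singleton_eq_univ (π : T ⟶ Spec (.of l)) (s : Spec (.of l)) :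
    (π ⁻¹' {s} : Set T) = Set.univ :=
  Set.eq_univ_of_forall fun _ ↦ Subsingleton.elim (α := PrimeSpectrum l) _ _

lemma isSmoothProjectiveCurve_iff_topologicalKrullDim :
    IsSmoothProjectiveCurve π ↔ Smooth π ∧ IsProper π ∧ GeometricallyIntegral π ∧
      topologicalKrullDim T = 1 := by
  have hdim (s : Spec (.of l)) :
      topologicalKrullDim (π ⁻¹' {s} : Set T) = topologicalKrullDim T := by
    rw [preimage_singleton_eq_univ]
    exact (Homeomorph.Set.univ T).isHomeomorph.topologicalKrullDim_eq
  exact ⟨fun ⟨hs, hp, hi, hd⟩ ↦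
      ⟨hs, hp, hi, hdim (Classical.arbitrary (PrimeSpectrum l)) ▸ hd _⟩,
    fun ⟨hs, hp, hi, hd⟩ ↦ ⟨hs, hp, hi, fun s ↦ (hdim s).trans hd⟩⟩

lemma forall_not_subsingleton_image_iff {P : Scheme.{u}} (F : T ⟶ P) :
    (∀ s : Spec (.of l), ¬ (F '' (π ⁻¹' {s} : Set T)).Subsingleton) ↔
      ¬ (Set.range F).Subsingleton := by
  simp only [preimage_singleton_eq_univ, Set.image_univ]
  exact ⟨fun h ↦ h (Classical.arbitrary (PrimeSpectrum l)), fun h _ ↦ h⟩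

lemma irreducibleSpace_of_geometricallyIntegral (π : T ⟶ Spec (.of l))
    [GeometricallyIntegral π] : IrreducibleSpace T :=
  have : Subsingleton (Spec (.of l)) := inferInstanceAs (Subsingleton (PrimeSpectrum l))
  have : Nonempty (Spec (.of l)) := inferInstanceAs (Nonempty (PrimeSpectrum l))
  GeometricallyIrreducible.irreducibleSpace_of_subsingleton π

end field

section extension

variable {l L : Type u} [Field l] [Field L] {T' T : Scheme.{u}} {g : T' ⟶ T}
  {π' : T' ⟶ Spec (.of L)} {π : T ⟶ Spec (.of l)} {v : Spec (.of L) ⟶ Spec (.of l)}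

lemma isSmoothProjectiveCurve_iff_of_isPullback (h : IsPullback g π' π v) [IsIntegralHom v] :
    IsSmoothProjectiveCurve π' ↔ IsSmoothProjectiveCurve π := by
  have hv : fpqc v := fpqc_of_field v
  have : Surjective v := hv.1.1
  have : Surjective g := MorphismProperty.of_isPullback h.flip ‹Surjective v›
  have : IsIntegralHom g := MorphismProperty.of_isPullback h.flip ‹IsIntegralHom v›
  rw [isSmoothProjectiveCurve_iff_topologicalKrullDim,
    isSmoothProjectiveCurve_iff_topologicalKrullDim, topologicalKrullDim_eq_of_isIntegralHom g]
  constructor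
  · rintro ⟨hs, hp, hi, hd⟩
    have : IsSeparated π := isSeparated_of_isPullback_of_fpqc h hv
    have : UniversallyClosed π :=
      MorphismProperty.of_isPullback_of_descendsAlong (Q := fpqc) h.flip hv inferInstance
    have : LocallyOfFiniteType π :=
      MorphismProperty.of_isPullback_of_descendsAlong (Q := fpqc) h.flip hv inferInstance
    exact ⟨MorphismProperty.of_isPullback_of_descendsAlong (Q := fpqc) h.flip hv hs, ⟨⟩,
      geometricallyIntegral_of_isPullback_of_surjective h, hd⟩
  · rintro ⟨hs, hp, hi, hd⟩
    exact ⟨MorphismProperty.of_isPullback h hs, MorphismProperty.of_isPullback h hp,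
      MorphismProperty.of_isPullback h hi, hd⟩

lemma isVariety_iff_of_isPullback (h : IsPullback g π' π v) : IsVariety π' ↔ IsVariety π := by
  have hv : fpqc v := fpqc_of_field v
  have : Surjective v := hv.1.1
  constructor
  · rintro ⟨hs, hft, hqc⟩
    exact ⟨isSeparated_of_isPullback_of_fpqc h hv,
      MorphismProperty.of_isPullback_of_descendsAlong (Q := fpqc) h.flip hv hft,
      quasiCompact_of_isPullback_of_surjective h⟩
  · rintro ⟨hs, hft, hqc⟩
    exact ⟨MorphismProperty.of_isPullback h hs, MorphismProperty.of_isPullback h hft,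
      MorphismProperty.of_isPullback h hqc⟩

end extension

namespace Family

variable {k : Type u} [Field k] {κ : Kind k}

/-- The morphism `B ×_k S ⟶ B ×_k S'` induced by `S ⟶ S'`, for `B` the base of the kind `κ`. -/
def prodMap (κ : Kind k) {S S' : Over (Spec (.of k))} (f : S ⟶ S') :
    pullback κ.base.hom S.hom ⟶ pullback κ.base.hom S'.hom :=
  pullback.lift (pullback.fst _ _) (pullback.snd _ _ ≫ f.left)
    (by rw [Category.assoc, Over.w f, pullback.condition])

lemma isPullback_prodMap (κ : Kind k) {S S' : Over (Spec (.of k))} (f : S ⟶ S') :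
    IsPullback (prodMap κ f) (pullback.snd κ.base.hom S.hom) (pullback.snd κ.base.hom S'.hom)
      f.left := by
  refine IsPullback.of_right (h₁₂ := pullback.fst _ _) ?_ (pullback.lift_snd _ _ _)
    (IsPullback.of_hasPullback κ.base.hom S'.hom)
  rw [prodMap, pullback.lift_fst, Over.w f]
  exact IsPullback.of_hasPullback κ.base.hom S.hom

lemma CartHom.toProd_comp_prodMap {S S' : Over (Spec (.of k))} {T : Family κ S}
    {T' : Family κ S'} {f : S ⟶ S'} (a : T.CartHom T' f) :
    T.toProd ≫ prodMap κ f = a.top ≫ T'.toProd := by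
  apply pullback.hom_ext
  · rw [Category.assoc, Category.assoc, T'.toProd_fst, a.top_φ, prodMap, pullback.lift_fst,
      T.toProd_fst]
  · rw [Category.assoc, Category.assoc, T'.toProd_snd, a.isPullback.w, prodMap, pullback.lift_snd,
      ← Category.assoc, T.toProd_snd]

lemma CartHom.subsingleton_range_toProd_iff {S S' : Over (Spec (.of k))} {T : Family κ S}
    {T' : Family κ S'} {f : S ⟶ S'} (a : T.CartHom T' f) [hf : IsIntegralHom f.left]
    [Surjective a.top] [IrreducibleSpace T.T] :
    (Set.range T.toProd).Subsingleton ↔ (Set.range T'.toProd).Subsingleton := by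
  have : IsIntegralHom (prodMap κ f) :=
    MorphismProperty.of_isPullback (isPullback_prodMap κ f).flip hf
  have hcomm (x : T.T) : prodMap κ f (T.toProd x) = T'.toProd (a.top x) := by
    rw [← Scheme.Hom.comp_apply, a.toProd_comp_prodMap, Scheme.Hom.comp_apply]
  constructor
  · rintro h _ ⟨x, rfl⟩ _ ⟨y, rfl⟩
    obtain ⟨x, rfl⟩ := a.top.surjective x
    obtain ⟨y, rfl⟩ := a.top.surjective y
    rw [← hcomm, ← hcomm, h ⟨x, rfl⟩ ⟨y, rfl⟩]
  · intro h
    have hgen (x : T.T) : T.toProd (genericPoint T.T) = T.toProd x := by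
      refine eq_of_specializes_of_isIntegralHom (prodMap κ f)
        ((genericPoint_specializes x).map T.toProd.continuous) ?_
      rw [hcomm, hcomm]
      exact h ⟨_, rfl⟩ ⟨_, rfl⟩
    rintro _ ⟨x, rfl⟩ _ ⟨y, rfl⟩
    rw [← hgen x, ← hgen y]

lemma CartHom.isAdmissible_iff {l L : Type u} [Field l] [Field L] [Algebra k l] [Algebra k L]
    {T' : Family κ (specOver k L)} {T : Family κ (specOver k l)}
    {f : specOver k L ⟶ specOver k l} (a : T'.CartHom T f) [hf : IsIntegralHom f.left] :
    T'.IsAdmissible ↔ T.IsAdmissible := by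
  let v : Spec (.of L) ⟶ Spec (.of l) := f.left
  have : IsIntegralHom v := hf
  have h : IsPullback (X := T.T) (Y := Spec (.of L)) (Z := Spec (.of l)) a.top T'.π T.π v :=
    a.isPullback
  match κ with
  | .variety => exact isVariety_iff_of_isPullback h
  | .cover _ _ =>
    refine Iff.trans (and_congr_right fun hcurve ↦ ?_)
      (and_congr_left' (isSmoothProjectiveCurve_iff_of_isPullback h))
    have : GeometricallyIntegral (Y := Spec (.of L)) T'.π := hcurve.geometricallyIntegral
    have : IrreducibleSpace T'.T := irreducibleSpace_of_geometricallyIntegral (l := L) T'.π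
    have : Surjective v := (fpqc_of_field v).1.1
    have : Surjective a.top := MorphismProperty.of_isPullback h.flip ‹Surjective v›
    exact (forall_not_subsingleton_image_iff (π := T'.π) T'.toProd).trans
      (a.subsingleton_range_toProd_iff.not.trans
        (forall_not_subsingleton_image_iff (π := T.π) T.toProd).symm)

end Family

/-! ### The spectrum of an algebraic extension as a limit -/

section limit

variable (k L : Type u) [Field k] [Field L] [Algebra k L]

/-- The finite subextensions of an extension of fields. -/
abbrev FinSub : Type u := {E : IntermediateField k L // FiniteDimensional k E}

instance : IsDirectedOrder (FinSub k L) where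
  directed E F := by
    have := E.2
    have := F.2
    exact ⟨⟨E.1 ⊔ F.1, inferInstance⟩, le_sup_left (a := E.1), le_sup_right (a := E.1)⟩

instance : Nonempty (FinSub k L) := ⟨⟨⊥, inferInstance⟩⟩

namespace FinSub

/-- The finite subextensions, as a diagram of rings. -/
def ringFunctor : FinSub k L ⥤ CommRingCat.{u} where
  obj E := .of E.1
  map h := CommRingCat.ofHom (IntermediateField.inclusion (leOfHom h)).toRingHom
  map_id _ := rfl
  map_comp _ _ := rfl

/-- The cocone on the finite subextensions of `L` with point `L`. -/
def ringCocone : Cocone (ringFunctor k L) where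
  pt := .of L
  ι := { app := fun E ↦ CommRingCat.ofHom (algebraMap E.1 L) }

lemma nonempty_isColimit_ringCocone [Algebra.IsAlgebraic k L] :
    Nonempty (IsColimit (ringCocone k L)) := by
  have : ReflectsFilteredColimits (forget CommRingCat.{u}) :=
    ⟨fun _ ↦ reflectsColimitsOfShape_of_reflectsIsomorphisms⟩
  refine ReflectsColimit.reflects (F := forget _) (Types.FilteredColimit.isColimitOf' _ _ ?_ ?_)
  · intro (x : L)
    have : FiniteDimensional k (IntermediateField.adjoin k {x}) :=
      IntermediateField.adjoin.finiteDimensional (Algebra.IsIntegral.isIntegral x)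
    exact ⟨⟨_, this⟩, ⟨x, IntermediateField.mem_adjoin_simple_self k x⟩, rfl⟩
  · exact fun E x y h ↦ ⟨E, 𝟙 _, congrArg _ (Subtype.ext h)⟩

/-- The spectra of the finite subextensions. -/
def specFunctor : (FinSub k L)ᵒᵖ ⥤ Scheme.{u} := (ringFunctor k L).op ⋙ Scheme.Spec

/-- The cone with point `Spec L` on the spectra of the finite subextensions. -/
def specCone : Cone (specFunctor k L) := Scheme.Spec.mapCone (ringCocone k L).op

lemma nonempty_isLimit_specCone [Algebra.IsAlgebraic k L] : Nonempty (IsLimit (specCone k L)) :=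
  ⟨isLimitOfPreserves Scheme.Spec (nonempty_isColimit_ringCocone k L).some.op⟩

end FinSub

variable {k L}

/-- `Spec F ⟶ Spec E` for an extension of fields `F` of `E`. -/
abbrev specExt (E F : Type u) [Field E] [Field F] [Algebra E F] : Spec (.of F) ⟶ Spec (.of E) :=
  Spec.map (CommRingCat.ofHom (algebraMap E F))

lemma specExt_comp (E F G : Type u) [Field E] [Field F] [Algebra E F] [Field G] [Algebra E G]
    [Algebra F G] [IsScalarTower E F G] : specExt F G ≫ specExt E F = specExt E G := by
  rw [← Spec.map_comp, ← CommRingCat.ofHom_comp, ← IsScalarTower.algebraMap_eq]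

/-- `Spec F ⟶ Spec E` for subextensions `E ≤ F`. -/
abbrev specIncl {E F : IntermediateField k L} (h : E ≤ F) : Spec (.of F) ⟶ Spec (.of E) :=
  Spec.map (CommRingCat.ofHom (IntermediateField.inclusion h).toRingHom)

lemma specIncl_comp_specExt {E F : IntermediateField k L} (h : E ≤ F) :
    specIncl h ≫ specExt k E = specExt k F := by
  rw [← Spec.map_comp, ← CommRingCat.ofHom_comp]
  rfl

lemma specExt_comp_specIncl {E F : IntermediateField k L} (h : E ≤ F) :
    specExt F L ≫ specIncl h = specExt E L := by
  rw [← Spec.map_comp, ← CommRingCat.ofHom_comp]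
  rfl

variable {T : Scheme.{u}} (π : T ⟶ Spec (.of k))

/-- The transition maps between the base changes of `T` to subextensions. -/
def pullbackIncl {E F : IntermediateField k L} (h : E ≤ F) :
    pullback π (specExt k F) ⟶ pullback π (specExt k E) :=
  pullback.lift (pullback.fst _ _) (pullback.snd _ _ ≫ specIncl h) (by
    rw [pullback.condition, Category.assoc, specIncl_comp_specExt])

lemma pullbackIncl_fst {E F : IntermediateField k L} (h : E ≤ F) :
    pullbackIncl π h ≫ pullback.fst _ _ = pullback.fst _ _ :=
  pullback.lift_fst _ _ _

lemma pullbackIncl_snd {E F : IntermediateField k L} (h : E ≤ F) :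
    pullbackIncl π h ≫ pullback.snd _ _ = pullback.snd _ _ ≫ specIncl h :=
  pullback.lift_snd _ _ _

lemma isPullback_pullbackIncl {E F : IntermediateField k L} (h : E ≤ F) :
    IsPullback (pullbackIncl π h) (pullback.snd π (specExt k F)) (pullback.snd π (specExt k E))
      (specIncl h) := by
  refine IsPullback.of_right ?_ (pullbackIncl_snd π h) (IsPullback.of_hasPullback _ _)
  rw [pullbackIncl_fst, specIncl_comp_specExt]
  exact IsPullback.of_hasPullback _ _

/-- The base changes of `T` to the finite subextensions. -/
def FinSub.schemeFunctor : (FinSub k L)ᵒᵖ ⥤ Scheme.{u} where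
  obj E := pullback π (specExt k E.unop.1)
  map h := pullbackIncl π (leOfHom h.unop)
  map_id E := by
    apply pullback.hom_ext
    · rw [pullbackIncl_fst, Category.id_comp]
    · rw [pullbackIncl_snd, Category.id_comp]
      have : specIncl (le_refl E.unop.1) = 𝟙 _ := Spec.map_id _
      exact (congrArg (pullback.snd π (specExt k E.unop.1) ≫ ·) this).trans (Category.comp_id _)
  map_comp f g := by
    apply pullback.hom_ext
    · rw [Category.assoc, pullbackIncl_fst, pullbackIncl_fst, pullbackIncl_fst]
    · rw [Category.assoc, pullbackIncl_snd, pullbackIncl_snd, reassoc_of% pullbackIncl_snd,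
        ← Spec.map_comp, ← CommRingCat.ofHom_comp]
      rfl

instance isAffineHom_schemeFunctor_map {E F : (FinSub k L)ᵒᵖ} (f : E ⟶ F) :
    IsAffineHom ((FinSub.schemeFunctor π).map f) :=
  MorphismProperty.of_isPullback (P := @IsAffineHom)
    (isPullback_pullbackIncl (π := π) (leOfHom f.unop)).flip inferInstance

instance compactSpace_schemeFunctor_obj [QuasiCompact π] (E : (FinSub k L)ᵒᵖ) :
    CompactSpace ((FinSub.schemeFunctor π).obj E) :=
  (quasiCompact_iff_compactSpace (f := pullback.snd π (specExt k E.unop.1))).mp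
    (inferInstanceAs (QuasiCompact (pullback.snd π (specExt k E.unop.1))))

lemma quasiSeparatedSpace_pullback [LocallyOfFiniteType π] (F : Type u) [Field F] [Algebra k F] :
    QuasiSeparatedSpace (pullback π (specExt k F) :) :=
  have := LocallyOfFiniteType.isLocallyNoetherian (pullback.snd π (specExt k F))
  inferInstance

instance quasiSeparatedSpace_schemeFunctor_obj [LocallyOfFiniteType π] (E : (FinSub k L)ᵒᵖ) :
    QuasiSeparatedSpace ((FinSub.schemeFunctor π).obj E) :=
  quasiSeparatedSpace_pullback π E.unop.1

variable {π} {TL : Scheme.{u}} {g : TL ⟶ T} {q : TL ⟶ Spec (.of L)}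

/-- The map from the base change to `L` to the base change to a subextension. -/
def pullbackProj (h : IsPullback g q π (specExt k L)) (E : IntermediateField k L) :
    TL ⟶ pullback π (specExt k E) :=
  pullback.lift g (q ≫ specExt E L) (by rw [h.w, Category.assoc, specExt_comp])

lemma pullbackProj_fst (h : IsPullback g q π (specExt k L)) (E : IntermediateField k L) :
    pullbackProj h E ≫ pullback.fst _ _ = g :=
  pullback.lift_fst _ _ _

lemma pullbackProj_snd (h : IsPullback g q π (specExt k L)) (E : IntermediateField k L) :
    pullbackProj h E ≫ pullback.snd _ _ = q ≫ specExt E L :=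
  pullback.lift_snd _ _ _

lemma isPullback_pullbackProj (h : IsPullback g q π (specExt k L)) (E : IntermediateField k L) :
    IsPullback (pullbackProj h E) q (pullback.snd π (specExt k E)) (specExt E L) := by
  refine IsPullback.of_right ?_ (pullbackProj_snd h E) (IsPullback.of_hasPullback _ _)
  rwa [pullbackProj_fst, specExt_comp]

lemma pullbackProj_pullbackIncl (h : IsPullback g q π (specExt k L)) {E F : IntermediateField k L}
    (hEF : E ≤ F) : pullbackProj h F ≫ pullbackIncl π hEF = pullbackProj h E := by
  apply pullback.hom_ext
  · rw [Category.assoc, pullbackIncl_fst, pullbackProj_fst, pullbackProj_fst]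
  · rw [Category.assoc, pullbackIncl_snd, reassoc_of% pullbackProj_snd, pullbackProj_snd,
      specExt_comp_specIncl]

/-- The base change to `L`, as a cone on the base changes to the finite subextensions. -/
def FinSub.schemeCone (h : IsPullback g q π (specExt k L)) :
    Cone (FinSub.schemeFunctor (L := L) π) where
  pt := TL
  π :=
    { app := fun E ↦ pullbackProj h E.unop.1
      naturality := fun _ _ f ↦
        (Category.id_comp _).trans (pullbackProj_pullbackIncl h (leOfHom f.unop)).symm }

section algebraic

variable [Algebra.IsAlgebraic k L]

lemma FinSub.nonempty_isLimit_schemeCone (h : IsPullback g q π (specExt k L)) :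
    Nonempty (IsLimit (FinSub.schemeCone h)) := by
  have : IsConnected (FinSub k L)ᵒᵖ := IsCofiltered.isConnected _
  let α : FinSub.schemeFunctor (L := L) π ⟶ FinSub.specFunctor k L :=
    { app := fun E ↦ pullback.snd π (specExt k E.unop.1)
      naturality := fun _ _ f ↦ pullbackIncl_snd π (leOfHom f.unop) }
  exact ⟨isLimitOfIsPullbackOfIsConnected α (FinSub.schemeCone h) (FinSub.specCone k L)
    { hom := q, w := fun E ↦ (pullbackProj_snd h E.unop.1).symm }
    (fun E ↦ isPullback_pullbackProj h E.unop.1) (nonempty_isLimit_specCone k L).some⟩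

lemma exists_pullbackProj_comp_eq [QuasiCompact π] [LocallyOfFiniteType π]
    (h : IsPullback g q π (specExt k L)) {B : Scheme.{u}} (πB : B ⟶ Spec (.of k))
    [LocallyOfFinitePresentation πB] (a : TL ⟶ B) (ha : a ≫ πB = g ≫ π) :
    ∃ (E : FinSub k L) (b : pullback π (specExt k E.1) ⟶ B), pullbackProj h E.1 ≫ b = a ∧
      b ≫ πB = pullback.fst _ _ ≫ π := by
  let t : FinSub.schemeFunctor (L := L) π ⟶ (Functor.const _).obj (Spec (.of k)) :=
    { app := fun E ↦ pullback.fst π (specExt k E.unop.1) ≫ π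
      naturality := fun _ _ f ↦ by
        refine Eq.trans ?_ (Category.comp_id _).symm
        exact (reassoc_of% pullbackIncl_fst π (leOfHom f.unop)) π }
  obtain ⟨E, b, hb, hb'⟩ := Scheme.exists_π_app_comp_eq_of_locallyOfFinitePresentation
    (FinSub.schemeFunctor (L := L) π) t πB (FinSub.schemeCone h)
    (FinSub.nonempty_isLimit_schemeCone h).some a (by
      ext E : 2
      exact ((reassoc_of% pullbackProj_fst h E.unop.1) π).trans ha.symm)
  exact ⟨E.unop, b, hb, hb'⟩

lemma exists_pullbackProj_preimage_eq (h : IsPullback g q π (specExt k L)) (U : TL.Opens)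
    (hU : IsCompact (U : Set TL)) :
    ∃ (E : FinSub k L) (V : (pullback π (specExt k E.1)).Opens),
      IsCompact (V : Set (pullback π (specExt k E.1) :)) ∧ pullbackProj h E.1 ⁻¹ᵁ V = U := by
  obtain ⟨E, V, hV, hVU⟩ := exists_preimage_eq (FinSub.schemeFunctor (L := L) π)
    (FinSub.schemeCone h) (FinSub.nonempty_isLimit_schemeCone h).some U hU
  exact ⟨E.unop, V, hV, hVU⟩

end algebraic

lemma isIso_of_isPullback_of_fpqc {X Y X' S S' : Scheme.{u}} {m : X ⟶ Y} {a : X' ⟶ X}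
    {πX : X ⟶ S} {πY : Y ⟶ S} {π' : X' ⟶ S'} {v : S' ⟶ S} (hX : IsPullback a π' πX v)
    (hY : IsPullback (a ≫ m) π' πY v) (hm : m ≫ πY = πX) (hv : fpqc v) : IsIso m := by
  have hpb : IsPullback a (𝟙 _) m (a ≫ m) :=
    IsPullback.of_bot (by rwa [hm, Category.id_comp]) (Category.id_comp _).symm hY
  have ham : fpqc (a ≫ m) := MorphismProperty.of_isPullback hY.flip hv
  exact MorphismProperty.of_isPullback_of_descendsAlong (P := .isomorphisms _) (Q := fpqc)
    hpb.flip ham (inferInstanceAs (IsIso (𝟙 _)))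

lemma exists_isPullback_of_isPullback [Algebra.IsAlgebraic k L] [QuasiCompact π]
    [LocallyOfFiniteType π] (h : IsPullback g q π (specExt k L)) {B : Scheme.{u}}
    {πB : B ⟶ Spec (.of k)} [LocallyOfFiniteType πB] {gB : TL ⟶ B}
    (hB : IsPullback gB q πB (specExt k L)) :
    ∃ (E : FinSub k L) (b : pullback π (specExt k E.1) ⟶ B), pullbackProj h E.1 ≫ b = gB ∧
      IsPullback b (pullback.snd _ _) πB (specExt k E.1) := by
  obtain ⟨E, b, hb, hbπ⟩ := exists_pullbackProj_comp_eq h πB gB (hB.w.trans h.w.symm)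
  refine ⟨E, b, hb, ?_⟩
  rw [pullback.condition] at hbπ
  let m := pullback.lift b (pullback.snd _ _) hbπ
  have hm_snd : m ≫ pullback.snd _ _ = pullback.snd _ _ := pullback.lift_snd _ _ _
  have hm : pullbackProj h E.1 ≫ m = pullbackProj hB E.1 := by
    apply pullback.hom_ext
    · rw [Category.assoc, pullback.lift_fst, hb, pullbackProj_fst]
    · rw [Category.assoc, hm_snd, pullbackProj_snd, pullbackProj_snd]
  have : IsIso m := isIso_of_isPullback_of_fpqc (isPullback_pullbackProj h E.1)
    (hm ▸ isPullback_pullbackProj hB E.1) hm_snd (fpqc_of_field _)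
  exact IsPullback.of_iso_pullback ⟨hbπ⟩ (asIso m) (pullback.lift_fst _ _ _) hm_snd

end limit

/-! ### Gluing along two open subschemes -/

section gluing

lemma isPullback_of_openCover_of_isPullback {T V T₀ U : Scheme.{u}} {g : T ⟶ T₀} {q : T ⟶ V}
    {π : T₀ ⟶ U} {v : V ⟶ U} (𝒰 : T₀.OpenCover) {S : 𝒰.I₀ → Scheme.{u}} (j : ∀ i, S i ⟶ T)
    (s : ∀ i, S i ⟶ 𝒰.X i) (hj : ∀ i, IsPullback (j i) (s i) g (𝒰.f i))
    (hs : ∀ i, IsPullback (s i) (j i ≫ q) (𝒰.f i ≫ π) v) : IsPullback g q π v := by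
  refine Scheme.isPullback_of_openCover _ _ _ _ 𝒰 fun i ↦ (hs i).of_iso (hj i).isoPullback
    (Iso.refl _) (Iso.refl _) (Iso.refl _) ?_ ?_ ?_ ?_
  · exact ((hj i).isoPullback_hom_snd.trans (Category.comp_id _).symm).symm
  · rw [Iso.refl_hom, Category.comp_id]
    exact ((hj i).isoPullback_hom_fst_assoc q).symm
  · simp
  · simp

/-- The open cover given by two jointly surjective open immersions. -/
def openCoverOfPair {T S O : Scheme.{u}} (jS : S ⟶ T) (jO : O ⟶ T) [IsOpenImmersion jS]
    [IsOpenImmersion jO] (h : ∀ x : T, x ∈ Set.range jS ∨ x ∈ Set.range jO) : T.OpenCover :=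
  Scheme.Cover.mkOfCovers (ULift.{u} Bool) (fun i ↦ bif i.down then S else O)
    (fun | ⟨true⟩ => jS | ⟨false⟩ => jO)
    (fun x ↦ (h x).elim (fun ⟨y, hy⟩ ↦ ⟨⟨true⟩, y, hy⟩) (fun ⟨y, hy⟩ ↦ ⟨⟨false⟩, y, hy⟩))
    (fun | ⟨true⟩ => ‹_› | ⟨false⟩ => ‹_›)

lemma exists_glue_pair {T S O W Z : Scheme.{u}} (jS : S ⟶ T) (jO : O ⟶ T) [IsOpenImmersion jS]
    [IsOpenImmersion jO] (h : ∀ x : T, x ∈ Set.range jS ∨ x ∈ Set.range jO) {wS : W ⟶ S}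
    {wO : W ⟶ O} (hW : IsPullback wS wO jS jO) (s : S ⟶ Z) (o : O ⟶ Z) (hso : wS ≫ s = wO ≫ o) :
    ∃ g : T ⟶ Z, jS ≫ g = s ∧ jO ≫ g = o := by
  have hSO : pullback.fst jS jO ≫ s = pullback.snd jS jO ≫ o := by
    rw [← cancel_epi hW.isoPullback.hom, hW.isoPullback_hom_fst_assoc,
      hW.isoPullback_hom_snd_assoc, hso]
  have hOS : pullback.fst jO jS ≫ o = pullback.snd jO jS ≫ s := by
    rw [← cancel_epi (pullbackSymmetry jS jO).hom, pullbackSymmetry_hom_comp_fst_assoc,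
      pullbackSymmetry_hom_comp_snd_assoc, hSO]
  let X : ULift.{u} Bool → Scheme.{u} := fun i ↦ bif i.down then S else O
  let f : ∀ i, X i ⟶ Z := fun | ⟨true⟩ => s | ⟨false⟩ => o
  let 𝒯 := openCoverOfPair jS jO h
  have hf : ∀ x y : ULift.{u} Bool, pullback.fst (𝒯.f x) (𝒯.f y) ≫ f x =
      pullback.snd (𝒯.f x) (𝒯.f y) ≫ f y := by
    rintro ⟨_ | _⟩ ⟨_ | _⟩
    · exact congr($(fst_eq_snd_of_mono_eq jO) ≫ o)
    · exact hOS
    · exact hSO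
    · exact congr($(fst_eq_snd_of_mono_eq jS) ≫ s)
  exact ⟨𝒯.glueMorphisms f hf, 𝒯.ι_glueMorphisms f hf ⟨true⟩, 𝒯.ι_glueMorphisms f hf ⟨false⟩⟩

lemma isPullback_of_pair {T V T₀ U S O S₀ O₀ : Scheme.{u}} {g : T ⟶ T₀} {q : T ⟶ V}
    {π : T₀ ⟶ U} {v : V ⟶ U} (jS : S₀ ⟶ T₀) (jO : O₀ ⟶ T₀) [IsOpenImmersion jS]
    [IsOpenImmersion jO] (h : ∀ x : T₀, x ∈ Set.range jS ∨ x ∈ Set.range jO) {iS : S ⟶ T}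
    {iO : O ⟶ T} {s : S ⟶ S₀} {o : O ⟶ O₀} (hiS : IsPullback iS s g jS)
    (hiO : IsPullback iO o g jO) (hs : IsPullback s (iS ≫ q) (jS ≫ π) v)
    (ho : IsPullback o (iO ≫ q) (jO ≫ π) v) : IsPullback g q π v := by
  let X : ULift.{u} Bool → Scheme.{u} := fun i ↦ bif i.down then S else O
  let X₀ : ULift.{u} Bool → Scheme.{u} := fun i ↦ bif i.down then S₀ else O₀
  let j : ∀ i, X i ⟶ T := fun | ⟨true⟩ => iS | ⟨false⟩ => iO
  let t : ∀ i, X i ⟶ X₀ i := fun | ⟨true⟩ => s | ⟨false⟩ => o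
  exact isPullback_of_openCover_of_isPullback (openCoverOfPair jS jO h) j t
    (fun | ⟨true⟩ => hiS | ⟨false⟩ => hiO) (fun | ⟨true⟩ => hs | ⟨false⟩ => ho)

section pushout

variable {A S O : Scheme.{u}} (a : A ⟶ S) (b : A ⟶ O) [IsOpenImmersion a] [IsOpenImmersion b]

instance isOpenImmersion_pushout_inl : IsOpenImmersion (pushout.inl a b) :=
  inferInstanceAs (IsOpenImmersion (colimit.ι (span a b) WalkingSpan.left))

instance isOpenImmersion_pushout_inr : IsOpenImmersion (pushout.inr a b) :=
  inferInstanceAs (IsOpenImmersion (colimit.ι (span a b) WalkingSpan.right))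

lemma mem_range_pushout_inl_or_inr (x : (pushout a b :)) :
    x ∈ Set.range (pushout.inl a b) ∨ x ∈ Set.range (pushout.inr a b) := by
  obtain ⟨i, y, hy⟩ := Scheme.IsLocallyDirected.ι_jointly_surjective (span a b) x
  match i with
  | none =>
    exact .inl ⟨a y, (congr($(colimit.w (span a b) WalkingSpan.Hom.fst) y)).trans hy⟩
  | some .left => exact .inl ⟨y, hy⟩
  | some .right => exact .inr ⟨y, hy⟩

lemma isPullback_pushout : IsPullback a b (pushout.inl a b) (pushout.inr a b) := by
  refine (IsOpenImmersion.isPullback b a (pushout.inr a b) (pushout.inl a b)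
    pushout.condition ?_).flip
  ext x
  constructor
  · rintro ⟨y, hy⟩
    obtain ⟨k, f, f', z, hz, -⟩ := (Scheme.IsLocallyDirected.ι_eq_ι_iff (span a b)
      (i := WalkingSpan.left) (j := WalkingSpan.right) (xi := x) (xj := y)).mp hy.symm
    match k, f, f' with
    | _, .init _, .init _ => exact ⟨z, hz⟩
  · rintro ⟨z, rfl⟩
    exact ⟨b z, congr($((pushout.condition (f := a) (g := b)).symm) z)⟩

end pushout

lemma isPullback_of_jointly_surjective {T T₀ S O W S₀ O₀ A : Scheme.{u}} {g : T ⟶ T₀}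
    {jS : S ⟶ T} {jO : O ⟶ T} [IsOpenImmersion jS]
    (hT : ∀ x : T, x ∈ Set.range jS ∨ x ∈ Set.range jO) {iS : S₀ ⟶ T₀} {iO : O₀ ⟶ T₀}
    [IsOpenImmersion iS] {wS : W ⟶ S} {wO : W ⟶ O} (hW : wS ≫ jS = wO ≫ jO) {a : A ⟶ S₀}
    {b : A ⟶ O₀} (hab : IsPullback a b iS iO) {gS : S ⟶ S₀} {gO : O ⟶ O₀} {gA : W ⟶ A}
    (hB : IsPullback wO gA gO b) (hgS : jS ≫ g = gS ≫ iS) (hgO : jO ≫ g = gO ≫ iO) :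
    IsPullback jS gS g iS := by
  refine (IsOpenImmersion.isPullback gS jS iS g hgS ?_).flip
  ext x
  constructor
  · rintro ⟨y, hy⟩
    obtain ⟨x, rfl⟩ | ⟨x, rfl⟩ := hT x
    · exact ⟨x, rfl⟩
    · obtain ⟨z, -, hz⟩ := Scheme.exists_preimage_of_isPullback hab y (gO x)
        (hy.trans congr($hgO x))
      obtain ⟨w, rfl, -⟩ := Scheme.exists_preimage_of_isPullback hB x z hz.symm
      exact ⟨wS w, congr($hW w)⟩
  · rintro ⟨x, rfl⟩
    exact ⟨gS x, congr($(hgS.symm) x)⟩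

lemma exists_isPullback_of_glue {T V U S O W S₀ O₀ A : Scheme.{u}} (q : T ⟶ V) (v : V ⟶ U)
    (jS : S ⟶ T) (jO : O ⟶ T) [IsOpenImmersion jS] [IsOpenImmersion jO]
    (hT : ∀ x : T, x ∈ Set.range jS ∨ x ∈ Set.range jO) {wS : W ⟶ S} {wO : W ⟶ O}
    (hW : IsPullback wS wO jS jO) (a : A ⟶ S₀) (b : A ⟶ O₀) [IsOpenImmersion a] [IsOpenImmersion b]
    {πS : S₀ ⟶ U} {πO : O₀ ⟶ U} (hab : a ≫ πS = b ≫ πO) {gS : S ⟶ S₀} {gO : O ⟶ O₀} {gA : W ⟶ A}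
    (hS : IsPullback gS (jS ≫ q) πS v) (hO : IsPullback gO (jO ≫ q) πO v)
    (hA : IsPullback wS gA gS a) (hB : IsPullback wO gA gO b) :
    ∃ (T₀ : Scheme.{u}) (π : T₀ ⟶ U) (g : T ⟶ T₀), IsPullback g q π v := by
  obtain ⟨g, hgS, hgO⟩ := exists_glue_pair jS jO hT hW (gS ≫ pushout.inl a b)
    (gO ≫ pushout.inr a b) (by rw [reassoc_of% hA.w, reassoc_of% hB.w, pushout.condition])
  have hpushout := isPullback_pushout a b
  have hinl : IsPullback jS gS g (pushout.inl a b) :=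
    isPullback_of_jointly_surjective hT hW.w hpushout hB hgS hgO
  have hinr : IsPullback jO gO g (pushout.inr a b) :=
    isPullback_of_jointly_surjective (fun x ↦ (hT x).symm) hW.w.symm hpushout.flip hA hgO hgS
  exact ⟨pushout a b, pushout.desc πS πO hab, g,
    isPullback_of_pair _ _ (mem_range_pushout_inl_or_inr a b) hinl hinr
      (by rwa [pushout.inl_desc]) (by rwa [pushout.inr_desc])⟩

end gluing

/-! ### Models over finite subextensions -/

section spread

variable {k L : Type u} [Field k] [Field L] [Algebra k L]

/-- An `L`-scheme has a model over a finite subextension of `L/k`. -/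
def HasFiniteModel (k : Type u) [Field k] [Algebra k L] {T : Scheme.{u}} (q : T ⟶ Spec (.of L)) :
    Prop :=
  ∃ (E : FinSub k L) (T₀ : Scheme.{u}) (π : T₀ ⟶ Spec (.of E.1)) (g : T ⟶ T₀),
    IsPullback g q π (specExt E.1 L)

lemma HasFiniteModel.of_finSub (F : FinSub k L) {T : Scheme.{u}} {q : T ⟶ Spec (.of L)}
    (h : HasFiniteModel F.1 q) : HasFiniteModel k q := by
  obtain ⟨E, T₀, π, g, hg⟩ := h
  have := F.2
  have := E.2
  have : FiniteDimensional k E.1 := FiniteDimensional.trans k F.1 E.1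
  exact ⟨⟨E.1.restrictScalars k, this⟩, T₀, π, g, hg⟩

lemma HasFiniteModel.of_iso {T T' : Scheme.{u}} (e : T' ≅ T) {q : T ⟶ Spec (.of L)}
    (h : HasFiniteModel k (e.hom ≫ q)) : HasFiniteModel k q := by
  obtain ⟨E, T₀, π, g, hg⟩ := h
  exact ⟨E, T₀, π, e.inv ≫ g, hg.of_iso e (Iso.refl _) (Iso.refl _) (Iso.refl _)
    (by simp) (by simp) (by simp) (by simp)⟩

lemma exists_isPullback_of_le {E F : IntermediateField k L} (h : E ≤ F) {T T₀ : Scheme.{u}}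
    {q : T ⟶ Spec (.of L)} {π : T₀ ⟶ Spec (.of E)} {g : T ⟶ T₀}
    (hg : IsPullback g q π (specExt E L)) :
    ∃ (T₁ : Scheme.{u}) (π₁ : T₁ ⟶ Spec (.of F)) (g₁ : T ⟶ T₁),
      IsPullback g₁ q π₁ (specExt F L) :=
  ⟨pullback π (specIncl h), pullback.snd _ _, pullback.lift g (q ≫ specExt F L) (by
    rw [hg.w, Category.assoc, specExt_comp_specIncl]), by
    refine IsPullback.of_right ?_ (pullback.lift_snd _ _ _) (IsPullback.of_hasPullback _ _)
    rwa [pullback.lift_fst, specExt_comp_specIncl]⟩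

lemma locallyOfFiniteType_of_isPullback_specExt {T T₀ : Scheme.{u}} {q : T ⟶ Spec (.of L)}
    {π : T₀ ⟶ Spec (.of k)} {g : T ⟶ T₀} (h : IsPullback g q π (specExt k L))
    [LocallyOfFiniteType q] : LocallyOfFiniteType π :=
  MorphismProperty.of_isPullback_of_descendsAlong (Q := fpqc) h.flip (fpqc_of_field _) ‹_›

lemma quasiCompact_of_isPullback_specExt {T T₀ : Scheme.{u}} {q : T ⟶ Spec (.of L)}
    {π : T₀ ⟶ Spec (.of k)} {g : T ⟶ T₀} (h : IsPullback g q π (specExt k L))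
    [CompactSpace T] : QuasiCompact π :=
  have : Surjective (specExt k L) := (fpqc_of_field _).1.1
  have : QuasiCompact q := (quasiCompact_iff_compactSpace q).mpr ‹_›
  quasiCompact_of_isPullback_of_surjective h

lemma exists_isPullback_opens {W S S₀ : Scheme.{u}} (w : W ⟶ S) [IsOpenImmersion w] (g : S ⟶ S₀)
    (A : S₀.Opens) (hA : g ⁻¹ᵁ A = w.opensRange) : ∃ gA : W ⟶ A, IsPullback w gA g A.ι := by
  have hrange : Set.range (w ≫ g) ⊆ Set.range A.ι := by
    rintro _ ⟨x, rfl⟩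
    have hx : w x ∈ g ⁻¹ᵁ A := hA.ge ⟨x, rfl⟩
    simpa using hx
  exact ⟨IsOpenImmersion.lift A.ι (w ≫ g) hrange,
    (IsOpenImmersion.isPullback _ w A.ι g (IsOpenImmersion.lift_fac _ _ _).symm
      (by rw [Scheme.Opens.opensRange_ι, hA])).flip⟩

lemma exists_isOpenImmersion_to_pullback {S S₀ W A X : Scheme.{u}} {g : S ⟶ S₀}
    {q : S ⟶ Spec (.of L)} {π : S₀ ⟶ Spec (.of k)} (hS : IsPullback g q π (specExt k L))
    {i : A ⟶ S₀} [IsOpenImmersion i] {w : W ⟶ S} {gA : W ⟶ A} (hA : IsPullback w gA g i)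
    (E : IntermediateField k L) {b : X ⟶ A} {πX : X ⟶ Spec (.of E)}
    (hX : IsPullback b πX (i ≫ π) (specExt k E)) {p : W ⟶ X} (hp : p ≫ b = gA)
    (hpπ : p ≫ πX = w ≫ q ≫ specExt E L) :
    ∃ a : X ⟶ pullback π (specExt k E), IsOpenImmersion a ∧ a ≫ pullback.snd _ _ = πX ∧
      IsPullback w p (pullbackProj hS E) a := by
  let a : X ⟶ pullback π (specExt k E) :=
    pullback.lift (b ≫ i) πX (by rw [Category.assoc, hX.w])
  have ha_fst : a ≫ pullback.fst _ _ = b ≫ i := pullback.lift_fst _ _ _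
  have ha_snd : a ≫ pullback.snd _ _ = πX := pullback.lift_snd _ _ _
  have ha : IsPullback b a i (pullback.fst _ _) := by
    refine IsPullback.of_bot ?_ ha_fst.symm (IsPullback.of_hasPullback π (specExt k E))
    rwa [ha_snd]
  refine ⟨a, MorphismProperty.of_isPullback ha inferInstance, ha_snd,
    (IsPullback.of_right (h₁₂ := b) (h₂₂ := pullback.fst _ _) ?_ ?_ ha).flip⟩
  · rw [hp, pullbackProj_fst]
    exact hA.flip
  · apply pullback.hom_ext
    · rw [Category.assoc, Category.assoc, ha_fst, reassoc_of% hp, pullbackProj_fst, hA.w]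
    · rw [Category.assoc, Category.assoc, ha_snd, pullbackProj_snd, hpπ]

section glue

variable {T S O : Scheme.{u}} {q : T ⟶ Spec (.of L)} [LocallyOfFiniteType q] (jS : S ⟶ T)
  (jO : O ⟶ T) [IsOpenImmersion jS] [IsOpenImmersion jO]
  [Algebra.IsAlgebraic k L] [CompactSpace (pullback jS jO :)]

lemma hasFiniteModel_of_glue_of_opens (hT : ∀ x : T, x ∈ Set.range jS ∨ x ∈ Set.range jO)
    {S₀ O₀ : Scheme.{u}} {πS : S₀ ⟶ Spec (.of k)}
    {πO : O₀ ⟶ Spec (.of k)} {gS : S ⟶ S₀} {gO : O ⟶ O₀}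
    (hS : IsPullback gS (jS ≫ q) πS (specExt k L)) (hO : IsPullback gO (jO ≫ q) πO (specExt k L))
    (A : S₀.Opens) (hA : gS ⁻¹ᵁ A = (pullback.fst jS jO).opensRange) (B : O₀.Opens)
    (hB : gO ⁻¹ᵁ B = (pullback.snd jS jO).opensRange) : HasFiniteModel k q := by
  obtain ⟨gA, hgA⟩ := exists_isPullback_opens (pullback.fst jS jO) gS A hA
  obtain ⟨gB, hgB⟩ := exists_isPullback_opens (pullback.snd jS jO) gO B hB
  have hWA : IsPullback gA (pullback.fst jS jO ≫ jS ≫ q) (A.ι ≫ πS) (specExt k L) :=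
    hgA.flip.paste_vert hS
  have hWB : IsPullback gB (pullback.fst jS jO ≫ jS ≫ q) (B.ι ≫ πO) (specExt k L) := by
    rw [pullback.condition_assoc]
    exact hgB.flip.paste_vert hO
  have := quasiCompact_of_isPullback_specExt hWA
  have := locallyOfFiniteType_of_isPullback_specExt hWA
  have := locallyOfFiniteType_of_isPullback_specExt hWB
  obtain ⟨E, b, hb, hpb⟩ := exists_isPullback_of_isPullback hWA hWB
  have hsnd := pullbackProj_snd hWA E.1
  simp only [Category.assoc] at hsnd
  obtain ⟨a, _, ha, hpa⟩ := exists_isOpenImmersion_to_pullback hS hgA E.1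
    (IsPullback.of_hasPullback _ _) (pullbackProj_fst hWA E.1) (by simpa only [Category.assoc])
  obtain ⟨c, _, hc, hpc⟩ := exists_isOpenImmersion_to_pullback hO hgB E.1 hpb hb
    (by simpa only [Category.assoc, pullback.condition_assoc] using hsnd)
  exact ⟨E, exists_isPullback_of_glue q (specExt E.1 L) jS jO hT (IsPullback.of_hasPullback _ _)
    a c (ha.trans hc.symm) (isPullback_pullbackProj hS E.1) (isPullback_pullbackProj hO E.1)
    hpa hpc⟩

lemma hasFiniteModel_of_glue (hT : ∀ x : T, x ∈ Set.range jS ∨ x ∈ Set.range jO)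
    {S₀ O₀ : Scheme.{u}} {πS : S₀ ⟶ Spec (.of k)}
    {πO : O₀ ⟶ Spec (.of k)} {gS : S ⟶ S₀} {gO : O ⟶ O₀}
    (hS : IsPullback gS (jS ≫ q) πS (specExt k L))
    (hO : IsPullback gO (jO ≫ q) πO (specExt k L)) : HasFiniteModel k q := by
  obtain ⟨E, A, -, hA⟩ := exists_pullbackProj_preimage_eq hS (pullback.fst jS jO).opensRange
    (isCompact_range (pullback.fst jS jO).continuous)
  obtain ⟨F, B, -, hB⟩ := exists_pullbackProj_preimage_eq hO (pullback.snd jS jO).opensRange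
    (isCompact_range (pullback.snd jS jO).continuous)
  obtain ⟨G, hEG, hFG⟩ := exists_ge_ge E F
  refine .of_finSub G (hasFiniteModel_of_glue_of_opens (k := G.1) jS jO hT
    (isPullback_pullbackProj hS G.1) (isPullback_pullbackProj hO G.1)
    (pullbackIncl πS hEG ⁻¹ᵁ A) ?_ (pullbackIncl πO hFG ⁻¹ᵁ B) ?_)
  · rw [← Scheme.Hom.comp_preimage, pullbackProj_pullbackIncl, hA]
  · rw [← Scheme.Hom.comp_preimage, pullbackProj_pullbackIncl, hB]

lemma HasFiniteModel.glue (hT : ∀ x : T, x ∈ Set.range jS ∨ x ∈ Set.range jO)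
    (hS : HasFiniteModel k (jS ≫ q)) (hO : HasFiniteModel k (jO ≫ q)) :
    HasFiniteModel k q := by
  obtain ⟨E, _, _, _, hE⟩ := hS
  obtain ⟨F, _, _, _, hF⟩ := hO
  obtain ⟨G, hEG, hFG⟩ := exists_ge_ge E F
  obtain ⟨_, _, _, hSG⟩ := exists_isPullback_of_le (show E.1 ≤ G.1 from hEG) hE
  obtain ⟨_, _, _, hOG⟩ := exists_isPullback_of_le (show F.1 ≤ G.1 from hFG) hF
  exact .of_finSub G (hasFiniteModel_of_glue (k := G.1) jS jO hT hSG hOG)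

end glue

variable [Algebra.IsAlgebraic k L]

lemma hasFiniteModel_specMap (A : Type u) [CommRing A] [Algebra L A]
    [Algebra.FinitePresentation L A] :
    HasFiniteModel k (Spec.map (CommRingCat.ofHom (algebraMap L A))) := by
  let P := Algebra.Presentation.ofFinitePresentation L A
  let E : IntermediateField k L := IntermediateField.adjoin k P.coeffs
  have hE : FiniteDimensional k E := by
    have := P.finite_coeffs.to_subtype
    exact IntermediateField.finiteDimensional_adjoin fun x _ ↦ Algebra.IsIntegral.isIntegral x
  have : P.HasCoeffs E := ⟨fun x hx ↦ ⟨⟨x, IntermediateField.subset_adjoin k _ hx⟩, rfl⟩⟩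
  let A₀ := P.ModelOfHasCoeffs E
  let e := P.tensorModelOfHasCoeffsEquiv E
  let f : A₀ →+* A := e.toRingHom.comp Algebra.TensorProduct.includeRight.toRingHom
  have h : IsPushout (CommRingCat.ofHom (algebraMap E A₀)) (CommRingCat.ofHom (algebraMap E L))
      (CommRingCat.ofHom f) (CommRingCat.ofHom (algebraMap L A)) := by
    refine ((CommRingCat.isPushout_tensorProduct E L A₀).of_iso (Iso.refl _) (Iso.refl _)
      (Iso.refl _) e.toRingEquiv.toCommRingCatIso ?_ ?_ ?_ ?_).flip
    · simp
    · simp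
    · ext x
      exact e.commutes x
    · rfl
  exact ⟨⟨E, hE⟩, Spec (.of A₀), Spec.map (CommRingCat.ofHom (algebraMap E A₀)),
    Spec.map (CommRingCat.ofHom f), isPullback_SpecMap_of_isPushout _ _ _ _ h⟩

lemma hasFiniteModel_of_isAffine {T : Scheme.{u}} [IsAffine T] (q : T ⟶ Spec (.of L))
    [LocallyOfFiniteType q] : HasFiniteModel k q := by
  refine .of_iso T.isoSpec.symm ?_
  obtain ⟨φ, hφ⟩ := Spec.map_surjective (T.isoSpec.symm.hom ≫ q)
  have : LocallyOfFiniteType (Spec.map φ) := hφ ▸ inferInstance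
  have hfp : φ.hom.FinitePresentation :=
    RingHom.FinitePresentation.of_finiteType.mp (HasRingHomProperty.Spec_iff.mp this)
  rw [← hφ]
  algebraize [φ.hom]
  exact hasFiniteModel_specMap Γ(T, ⊤)

theorem hasFiniteModel {T : Scheme.{u}} (q : T ⟶ Spec (.of L)) [LocallyOfFiniteType q]
    [QuasiCompact q] : HasFiniteModel k q := by
  have : CompactSpace T := (quasiCompact_iff_compactSpace q).mp ‹_›
  have : IsLocallyNoetherian T := LocallyOfFiniteType.isLocallyNoetherian q
  refine .of_iso (Scheme.topIso T) (compact_open_induction_on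
    (P := fun U : T.Opens ↦ HasFiniteModel k (U.ι ≫ q)) ⊤ isCompact_univ ?_ ?_)
  · have : IsAffine (⊥ : T.Opens) := isAffineOpen_bot T
    exact hasFiniteModel_of_isAffine _
  · intro S _ U h
    have : IsAffine U := U.2
    have : IsLocallyNoetherian (S ⊔ U.1 : T.Opens) := inferInstance
    refine HasFiniteModel.glue (T.homOfLE le_sup_left) (T.homOfLE le_sup_right)
      ?_ (by rwa [Scheme.homOfLE_ι_assoc])
      (by rw [Scheme.homOfLE_ι_assoc]; exact hasFiniteModel_of_isAffine _)
    rintro ⟨x, hx⟩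
    exact hx.imp (fun h ↦ ⟨⟨x, h⟩, Subtype.ext (by simp)⟩) (fun h ↦ ⟨⟨x, h⟩, Subtype.ext (by simp)⟩)

end spread

/-! ### Families over finite subextensions -/

section

variable {k : Type u} [Field k] {κ : Kind k}

lemma Family.IsAdmissible.locallyOfFiniteType {S : Over (Spec (.of k))} {T : Family κ S}
    (h : T.IsAdmissible) : LocallyOfFiniteType T.π := by
  cases κ with
  | variety => exact IsVariety.locallyOfFiniteType h
  | cover C hC =>
    have := IsSmoothProjectiveCurve.proper h.1
    infer_instance

lemma Family.IsAdmissible.quasiCompact {S : Over (Spec (.of k))} {T : Family κ S}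
    (h : T.IsAdmissible) : QuasiCompact T.π := by
  cases κ with
  | variety => exact IsVariety.quasiCompact h
  | cover C hC =>
    have := IsSmoothProjectiveCurve.proper h.1
    infer_instance

lemma Kind.locallyOfFiniteType_base_hom (κ : Kind k) : LocallyOfFiniteType κ.base.hom := by
  cases κ with
  | variety => exact inferInstanceAs (LocallyOfFiniteType (𝟙 _))
  | cover C hC =>
    have := hC.proper
    exact inferInstanceAs (LocallyOfFiniteType C.hom)

lemma isIntegralHom_specOverMap {l L : Type u} [Field l] [Field L] [Algebra k l] [Algebra k L]
    [Algebra.IsAlgebraic k L] (e : l →ₐ[k] L) : IsIntegralHom (specOverMap e).left := by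
  refine (IsIntegralHom.SpecMap_iff (φ := CommRingCat.ofHom e.toRingHom)).mpr ?_
  refine RingHom.IsIntegral.tower_top (algebraMap k l) e.toRingHom ?_
  have he : e.toRingHom.comp (algebraMap k l) = algebraMap k L := e.comp_algebraMap
  rw [he]
  exact Algebra.IsIntegral.isIntegral

instance isScalarTower_intermediateField {E K : Type u} [Field E] [Field K] [Algebra k E]
    [Algebra k K] [Algebra E K] [IsScalarTower k E K] (F : IntermediateField E K) :
    IsScalarTower k F K :=
  .of_algebraMap_eq fun _ ↦ rfl

/-- The morphism `Spec K ⟶ Spec E` of `k`-schemes attached to a tower of extensions. -/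
abbrev specOverExt (k E K : Type u) [Field k] [Field E] [Field K] [Algebra k E] [Algebra k K]
    [Algebra E K] [IsScalarTower k E K] : specOver k K ⟶ specOver k E :=
  specOverMap (IsScalarTower.toAlgHom k E K)

lemma Family.exists_cartHom_finSub {E K : Type u} [Field E] [Field K] [Algebra k E] [Algebra k K]
    [Algebra E K] [IsScalarTower k E K] [Algebra.IsAlgebraic E K] {X : Family κ (specOver k K)}
    {M M' : Family κ (specOver k E)} [LocallyOfFiniteType M.π] [QuasiCompact M.π]
    [LocallyOfFiniteType M'.π] (a : X.CartHom M (specOverExt k E K))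
    (a' : X.CartHom M' (specOverExt k E K)) :
    ∃ (F : FinSub E K) (N : Family κ (specOver k F.1)),
      Nonempty (X.CartHom N (specOverExt k F.1 K)) ∧ Nonempty (N.CartHom M (specOverExt k E F.1)) ∧
        Nonempty (N.CartHom M' (specOverExt k E F.1)) := by
  let π : M.T ⟶ Spec (.of E) := M.π
  let π' : M'.T ⟶ Spec (.of E) := M'.π
  have : LocallyOfFiniteType π := ‹LocallyOfFiniteType M.π›
  have : QuasiCompact π := ‹QuasiCompact M.π›
  have : LocallyOfFiniteType π' := ‹LocallyOfFiniteType M'.π›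
  have ha : IsPullback (Y := Spec (.of K)) a.top X.π π (specExt E K) := a.isPullback
  have ha' : IsPullback (Y := Spec (.of K)) a'.top X.π π' (specExt E K) := a'.isPullback
  obtain ⟨F, b, hb, hb'⟩ := exists_isPullback_of_isPullback ha ha'
  refine ⟨F, M.baseChange (specOverExt k E F.1), ⟨a.lift (M.baseChangeHom _) ?_⟩,
    ⟨M.baseChangeHom _⟩, ⟨⟨b, hb', ?_⟩⟩⟩
  · exact Over.OverMorphism.ext (specExt_comp E F.1 K)
  · have hproj : fpqc (pullbackProj ha F.1) :=
      MorphismProperty.of_isPullback (isPullback_pullbackProj ha F.1).flip (fpqc_of_field _)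
    have : Surjective (pullbackProj ha F.1) := hproj.1.1
    have : Flat (pullbackProj ha F.1) := hproj.1.2
    have : Epi (pullbackProj ha F.1) := Flat.epi_of_flat_of_surjective _
    change (b ≫ M'.φ : pullback π (specExt E F.1) ⟶ _) = pullback.fst _ _ ≫ M.φ
    rw [← cancel_epi (pullbackProj ha F.1), reassoc_of% hb, a'.top_φ, ← a.top_φ]
    exact ((reassoc_of% pullbackProj_fst ha F.1) M.φ).symm

lemma Family.exists_cartHom_of_quasiCompact {L : Type u} [Field L] [Algebra k L]
    [Algebra.IsAlgebraic k L] (X : Family κ (specOver k L)) [LocallyOfFiniteType X.π]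
    [QuasiCompact X.π] :
    ∃ (F : FinSub k L) (M : Family κ (specOver k F.1)),
      Nonempty (X.CartHom M (specOverMap F.1.val)) := by
  let q : X.T ⟶ Spec (.of L) := X.π
  have : LocallyOfFiniteType q := ‹LocallyOfFiniteType X.π›
  have : QuasiCompact q := ‹QuasiCompact X.π›
  obtain ⟨E, T₀, π, g, hg⟩ := hasFiniteModel (k := k) q
  have := locallyOfFiniteType_of_isPullback_specExt hg
  have : CompactSpace X.T := (quasiCompact_iff_compactSpace q).mp ‹_›
  have := quasiCompact_of_isPullback_specExt hg
  have := κ.locallyOfFiniteType_base_hom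
  let πB : pullback κ.base.hom (specExt k E.1) ⟶ Spec (.of E.1) := pullback.snd _ _
  obtain ⟨F, b, hb, hb'⟩ := exists_pullbackProj_comp_eq hg πB
    (pullback.lift X.φ (g ≫ π) (by
      rw [X.w, hg.w, Category.assoc, specExt_comp]
      rfl)) (pullback.lift_snd _ _ _)
  have := E.2
  have := F.2
  have hF : FiniteDimensional k F.1 := FiniteDimensional.trans k E.1 F.1
  refine ⟨⟨F.1.restrictScalars k, hF⟩, ⟨pullback π (specExt E.1 F.1), pullback.snd _ _,
    b ≫ pullback.fst _ _, ?_⟩, ⟨⟨pullbackProj hg F.1, isPullback_pullbackProj hg F.1, ?_⟩⟩⟩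
  · rw [Category.assoc, pullback.condition, reassoc_of% hb', pullback.condition_assoc,
      specExt_comp]
    rfl
  · rw [reassoc_of% hb, pullback.lift_fst]

end

section embeddings

variable {k l l' K : Type u} [Field k] [Field l] [Field l'] [Field K] [Algebra k l] [Algebra k l']
  [Algebra k K]

lemma specOverMap_comp (e : l →ₐ[k] l') (e' : l' →ₐ[k] K) :
    specOverMap e' ≫ specOverMap e = specOverMap (e'.comp e) := by
  apply Over.OverMorphism.ext
  change Spec.map _ ≫ Spec.map _ = Spec.map _
  rw [← Spec.map_comp]
  rfl

lemma exists_eq_specOverMap (f : specOver k l' ⟶ specOver k l) :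
    ∃ e : l →ₐ[k] l', f = specOverMap e := by
  let g : Spec (.of l') ⟶ Spec (.of l) := f.left
  obtain ⟨φ, hφ⟩ := Spec.map_surjective g
  have hφk : CommRingCat.ofHom (algebraMap k l) ≫ φ = CommRingCat.ofHom (algebraMap k l') := by
    apply Spec.map_injective
    rw [Spec.map_comp, hφ]
    exact Over.w f
  exact ⟨⟨φ.hom, fun x ↦ congr($hφk x)⟩, Over.OverMorphism.ext hφ.symm⟩

lemma exists_algEquiv_comp_eq [Normal k K] (i j : l →ₐ[k] K) :
    ∃ ρ : K ≃ₐ[k] K, (ρ : K →ₐ[k] K).comp i = j := by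
  let e : i.fieldRange ≃ₐ[k] j.fieldRange :=
    (AlgEquiv.ofInjectiveField i).symm.trans (AlgEquiv.ofInjectiveField j)
  refine ⟨e.liftNormal K, AlgHom.ext fun x ↦ ?_⟩
  have hx : e (AlgEquiv.ofInjectiveField i x) = AlgEquiv.ofInjectiveField j x :=
    congrArg (AlgEquiv.ofInjectiveField j) ((AlgEquiv.ofInjectiveField i).symm_apply_apply x)
  exact (e.liftNormal_commutes K (AlgEquiv.ofInjectiveField i x)).trans congr(($hx : K))

end embeddings

/-! ### Fields of moduli and fields of definition under functors -/

/-- The spectrum of a finite separable extension, as an object of the finite étale site. -/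
def FEt.ofField (k l : Type u) [Field k] [Field l] [Algebra k l] [FiniteDimensional k l]
    [Algebra.IsSeparable k l] : FEt k where
  toOver := specOver k l
  isFinite := (IsFinite.SpecMap_iff (CommRingCat.ofHom (algebraMap k l))).mpr
    (RingHom.finite_algebraMap.mpr ‹_›)
  etale := by
    have : Algebra.Etale k l :=
      ⟨Algebra.FormallyEtale.of_isSeparable k l,
        Algebra.FinitePresentation.of_finiteType.mp inferInstance⟩
    refine (HasRingHomProperty.Spec_iff (P := @Etale)).mpr ?_
    exact RingHom.etale_algebraMap.mpr this

namespace DescentObject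

variable {k K : Type u} [Field k] [Field K] [Algebra k K] {X Y : DescentObject k K}

/-- The family underlying a "model", considered over a base which is only propositionally equal to
that of the "model". -/
def Model.familyOn (M : X.Model) {U : FEt k} (h : M.U = U) : Family X.kind U.toOver :=
  h ▸ M.family

lemma Model.exists_cartHom_familyOn (M : X.Model) {U : FEt k} (h : M.U = U) (u : U.toOver.left) :
    ∃ g : specOver k K ⟶ U.toOver, Nonempty (X.toFamily.CartHom (M.familyOn h) g) := by
  subst h
  obtain ⟨g, -, hg⟩ := M.exists_geometricPoint u
  exact ⟨g, hg⟩

lemma Model.nonempty_cartHom_familyOn {M N : X.Model} (f : M ⟶ N) {U V : FEt k} (hM : M.U = U)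
    (hN : N.U = V) (g : U ⟶ V) [h : X.proj.IsHomLift g f] :
    Nonempty ((M.familyOn hM).CartHom (N.familyOn hN) (FEt.homToOver g)) := by
  subst hM hN
  obtain rfl : g = X.proj.map f :=
    @CategoryTheory.IsHomLift.eq_of_isHomLift _ _ _ _ X.proj M N g f h
  exact ⟨f.top, f.isPullback, f.top_φ⟩

/-- A family over an extension `l` of `k` is a form of `X` if it becomes isomorphic to `X` along
some embedding of `l` in `K`. -/
def IsForm (X : DescentObject k K) {l : Type u} [Field l] [Algebra k l]
    (T : Family X.kind (specOver k l)) : Prop :=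
  ∃ e : l →ₐ[k] K, Nonempty (X.toFamily.CartHom T (specOverMap e))

section forms

variable [Algebra.IsAlgebraic k K] {l l' : Type u} [Field l] [Algebra k l] [Field l'] [Algebra k l']

lemma IsForm.isAdmissible {T : Family X.kind (specOver k l)} (h : X.IsForm T) :
    T.IsAdmissible := by
  obtain ⟨e, ⟨a⟩⟩ := h
  have := isIntegralHom_specOverMap e
  exact a.isAdmissible_iff.mp X.isAdmissible

lemma exists_cartHom_finSub (X : DescentObject k K) :
    ∃ (E : FinSub k K) (M : Family X.kind (specOver k E.1)),
      Nonempty (X.toFamily.CartHom M (specOverMap E.1.val)) :=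
  have := X.isAdmissible.locallyOfFiniteType
  have := X.isAdmissible.quasiCompact
  X.toFamily.exists_cartHom_of_quasiCompact

lemma exists_common_form [FiniteDimensional k l] [FiniteDimensional k l']
    {M : Family X.kind (specOver k l)} {M' : Family X.kind (specOver k l')} {e : l →ₐ[k] K}
    {e' : l' →ₐ[k] K} (a : X.toFamily.CartHom M (specOverMap e))
    (a' : X.toFamily.CartHom M' (specOverMap e')) :
    ∃ (F : FinSub k K) (N : Family X.kind (specOver k F.1)) (f : l →ₐ[k] F.1) (f' : l' →ₐ[k] F.1),
      F.1.val.comp f = e ∧ F.1.val.comp f' = e' ∧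
      Nonempty (X.toFamily.CartHom N (specOverMap F.1.val)) ∧
      Nonempty (N.CartHom M (specOverMap f)) ∧ Nonempty (N.CartHom M' (specOverMap f')) := by
  let E : IntermediateField k K := e.fieldRange ⊔ e'.fieldRange
  have : FiniteDimensional k e.fieldRange :=
    inferInstanceAs (FiniteDimensional k e.toLinearMap.range)
  have : FiniteDimensional k e'.fieldRange :=
    inferInstanceAs (FiniteDimensional k e'.toLinearMap.range)
  have hE : FiniteDimensional k E := inferInstance
  let i : l →ₐ[k] E := e.codRestrict E.toSubalgebra
    fun x ↦ (le_sup_left : e.fieldRange ≤ E) ⟨x, rfl⟩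
  let i' : l' →ₐ[k] E := e'.codRestrict E.toSubalgebra
    fun x ↦ (le_sup_right : e'.fieldRange ≤ E) ⟨x, rfl⟩
  let b : X.toFamily.CartHom (M.baseChange (specOverMap i)) (specOverExt k E K) :=
    a.lift (M.baseChangeHom _) (specOverMap_comp i _)
  let b' : X.toFamily.CartHom (M'.baseChange (specOverMap i')) (specOverExt k E K) :=
    a'.lift (M'.baseChangeHom _) (specOverMap_comp i' _)
  have hM : (M.baseChange (specOverMap i)).IsAdmissible := IsForm.isAdmissible ⟨_, ⟨b⟩⟩
  have hM' : (M'.baseChange (specOverMap i')).IsAdmissible := IsForm.isAdmissible ⟨_, ⟨b'⟩⟩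
  have := hM.locallyOfFiniteType
  have := hM.quasiCompact
  have := hM'.locallyOfFiniteType
  obtain ⟨F, N, ⟨c⟩, ⟨d⟩, ⟨d'⟩⟩ := Family.exists_cartHom_finSub b b'
  have := F.2
  have hF : FiniteDimensional k F.1 := FiniteDimensional.trans k E F.1
  exact ⟨⟨F.1.restrictScalars k, hF⟩, N, (IsScalarTower.toAlgHom k E F.1).comp i,
    (IsScalarTower.toAlgHom k E F.1).comp i', rfl, rfl, ⟨c⟩,
    ⟨(d.comp (M.baseChangeHom _)).cast (specOverMap_comp i _)⟩,
    ⟨(d'.comp (M'.baseChangeHom _)).cast (specOverMap_comp i' _)⟩⟩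

lemma HasModelOver.exists_isForm {l : IntermediateField k K} (h : X.HasModelOver l) :
    ∃ (E : FinSub k l) (T : Family X.kind (specOver k E.1)), X.IsForm T := by
  obtain ⟨e, T, hT, ⟨a⟩⟩ := h
  have := hT.locallyOfFiniteType
  have := hT.quasiCompact
  obtain ⟨E, T₀, ⟨b⟩⟩ := T.exists_cartHom_of_quasiCompact
  exact ⟨E, T₀, e.comp E.1.val, ⟨(a.comp b).cast (specOverMap_comp _ _)⟩⟩

end forms

section normal

variable [Normal k K]

lemma HasFieldOfModuli.isFieldOfDefinition (hX : X.HasFieldOfModuli) {l : IntermediateField k K}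
    (h : X.HasModelOver l) : X.IsFieldOfDefinition l := by
  obtain ⟨e, T, hT, ⟨a⟩⟩ := h
  obtain ⟨ρ, hρ⟩ := exists_algEquiv_comp_eq e l.val
  obtain ⟨b⟩ := hX ρ
  exact ⟨T, hT, ⟨(b.comp a).cast ((specOverMap_comp e _).trans (congrArg _ hρ))⟩⟩

lemma IsForm.hasModelOver {l : IntermediateField k K} {E : IntermediateField k l}
    {T : Family X.kind (specOver k E)} (h : X.IsForm T) : X.HasModelOver l := by
  obtain ⟨e, ⟨a⟩⟩ := h
  obtain ⟨ρ, hρ⟩ := exists_algEquiv_comp_eq (l.val.comp E.val) e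
  let g : l →ₐ[k] K := (ρ : K →ₐ[k] K).comp l.val
  let b : X.toFamily.CartHom (T.baseChange (specOverMap E.val)) (specOverMap g) :=
    a.lift (T.baseChangeHom _) ((specOverMap_comp _ _).trans (congrArg _ hρ))
  exact ⟨g, _, IsForm.isAdmissible ⟨g, ⟨b⟩⟩, ⟨b⟩⟩

end normal

section functor

variable [Algebra.IsAlgebraic k K] {l l' : Type u} [Field l'] [Algebra k l']
  [FiniteDimensional k l'] [Algebra.IsSeparable k l'] [Field l] [Algebra k l]
  [FiniteDimensional k l] [Algebra.IsSeparable k l]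

/-- The "model" over `Spec l` given by a form of `X`. -/
def IsForm.model {T : Family X.kind (specOver k l)} (h : X.IsForm T) : X.Model where
  U := FEt.ofField k l
  family := T
  isAdmissible := h.isAdmissible
  exists_geometricPoint _ := by
    obtain ⟨e, a⟩ := h
    exact ⟨specOverMap e, ⟨Classical.arbitrary (PrimeSpectrum K),
      Subsingleton.elim (α := PrimeSpectrum l) _ _⟩, a⟩

variable (F : BasedFunctor X.models Y.models)

/-- The form of `Y` that a functor between categories of "models" assigns to a form of `X`. -/
def IsForm.map {T : Family X.kind (specOver k l)} (h : X.IsForm T) :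
    Family Y.kind (specOver k l) :=
  (F.obj h.model).familyOn (U := FEt.ofField k l) (F.w_obj h.model)

lemma IsForm.isForm_map {T : Family X.kind (specOver k l)} (h : X.IsForm T) :
    Y.IsForm (h.map F) := by
  obtain ⟨g, hg⟩ := Model.exists_cartHom_familyOn (F.obj h.model) (U := FEt.ofField k l)
    (F.w_obj h.model) (Classical.arbitrary (PrimeSpectrum l))
  obtain ⟨e, rfl⟩ := exists_eq_specOverMap g
  exact ⟨e, hg⟩

lemma IsForm.nonempty_cartHom_map {T : Family X.kind (specOver k l)}
    {T' : Family X.kind (specOver k l')} (h : X.IsForm T) (h' : X.IsForm T')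
    {f : specOver k l ⟶ specOver k l'} (a : T.CartHom T' f) :
    Nonempty ((h.map F).CartHom (h'.map F) f) := by
  let g : FEt.ofField k l ⟶ FEt.ofField k l' := f
  let m : h.model ⟶ h'.model := ⟨g, a.top, a.isPullback, a.top_φ⟩
  have : X.proj.IsHomLift g m := Functor.IsHomLift.map m
  have : Y.proj.IsHomLift g (F.map m) := F.preserves_isHomLift g m
  exact Model.nonempty_cartHom_familyOn (F.map m) _ _ g

end functor

section galois

variable [IsGalois k K] (F : BasedFunctor X.models Y.models)
include F

lemma HasModelOver.map {l : IntermediateField k K} (h : X.HasModelOver l) : Y.HasModelOver l := by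
  obtain ⟨E, T, hT⟩ := h.exists_isForm
  have := E.2
  have : Algebra.IsSeparable k l := inferInstance
  exact (hT.isForm_map F).hasModelOver

lemma HasFieldOfModuli.map (hX : X.HasFieldOfModuli) : Y.HasFieldOfModuli := by
  intro σ
  obtain ⟨E, M, ⟨a⟩⟩ := X.exists_cartHom_finSub
  have := E.2
  have hM : X.IsForm M := ⟨_, ⟨a⟩⟩
  obtain ⟨g, ⟨b⟩⟩ := hM.isForm_map F
  obtain ⟨ρ, hρ⟩ := exists_algEquiv_comp_eq E.1.val g
  -- The form of `Y` over `E` is embedded along `g` and not along the inclusion of `E`: the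
  -- automorphism to be lifted to `X` is therefore the conjugate of `σ` by an extension `ρ` of `g`.
  let τ : K ≃ₐ[k] K := (ρ.trans σ).trans ρ.symm
  obtain ⟨c⟩ := hX τ
  obtain ⟨G, N, f, f', hf, hf', ⟨aN⟩, ⟨n⟩, ⟨n'⟩⟩ := exists_common_form a
    ((c.comp a).cast (specOverMap_comp _ _))
  have := G.2
  have hN : X.IsForm N := ⟨_, ⟨aN⟩⟩
  obtain ⟨m⟩ := hN.nonempty_cartHom_map F hM n
  obtain ⟨m'⟩ := hN.nonempty_cartHom_map F hM n'
  let d : Y.toFamily.CartHom (hN.map F) (specOverMap ((ρ : K →ₐ[k] K).comp G.1.val)) :=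
    b.lift m (by rw [specOverMap_comp, AlgHom.comp_assoc, hf, hρ])
  have hσ : ((ρ : K →ₐ[k] K).comp G.1.val).comp f' = (σ : K →ₐ[k] K).comp g := by
    rw [AlgHom.comp_assoc, hf', ← hρ]
    ext x
    simp [τ]
  exact ⟨((d.comp m').cast (specOverMap_comp _ _)).lift b (by rw [specOverMap_comp, hσ])⟩

end galois

end DescentObject

/-! ### Galois descent of rings -/

section invariants

variable {G A : Type*} [Group G] [CommRing A]

/-- The subring of the invariants of a group acting on a ring through a homomorphism `ρ`. -/
def invariantSubring (ρ : G →* (A →+* A)) : Subring A :=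
  let _ : MulSemiringAction G A := .compHom A ρ
  FixedPoints.subring A G

lemma isUnit_invariantSubring {ρ : G →* (A →+* A)} {r : invariantSubring ρ}
    (hr : IsUnit (r : A)) : IsUnit r := by
  obtain ⟨u, hu⟩ := hr
  refine IsUnit.of_mul_eq_one ⟨((u⁻¹ : Aˣ) : A), fun σ ↦ ?_⟩ (Subtype.ext ?_)
  · have hσu : ρ σ u = u := by rw [hu]; exact r.2 σ
    have hσ : u * ρ σ ((u⁻¹ : Aˣ) : A) = 1 := by
      rw [← hσu, ← map_mul, u.mul_inv, map_one]
    exact (u.inv_eq_of_mul_eq_one_right hσ).symm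
  · change (r : A) * ((u⁻¹ : Aˣ) : A) = 1
    rw [← hu, u.mul_inv]

variable [Fintype G]

/-- The trace of a ring to the invariants of a finite group acting on it. -/
def invariantTrace (ρ : G →* (A →+* A)) : A →ₗ[invariantSubring ρ] invariantSubring ρ where
  toFun a := ⟨∑ σ, ρ σ a, fun τ ↦ by
    refine (_root_.map_sum (ρ τ) _ _).trans ?_
    refine Fintype.sum_bijective (τ * ·) (Group.mulLeft_bijective τ) _ _ fun σ ↦ ?_
    rw [map_mul]
    rfl⟩
  map_add' a b := Subtype.ext (by simp [Finset.sum_add_distrib])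
  map_smul' r a := Subtype.ext (by
    have hr (σ : G) : ρ σ r = r := r.2 σ
    simp [Subring.smul_def, hr, Finset.mul_sum])

lemma coe_invariantTrace (ρ : G →* (A →+* A)) (a : A) : (invariantTrace ρ a : A) = ∑ σ, ρ σ a :=
  rfl

section localization

variable {A' : Type*} [CommRing A'] [Algebra A A'] {ρ : G →* (A →+* A)} {ρ' : G →* (A' →+* A')}
  (hρ : ∀ σ a, ρ' σ (algebraMap A A' a) = algebraMap A A' (ρ σ a))
include hρ

lemma algebraMap_invariantTrace_mul {c : A} (hc : ∑ σ, ρ σ c = 1) {a : A}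
    (ha : ∀ σ, ρ' σ (algebraMap A A' a) = algebraMap A A' a) :
    algebraMap A A' (invariantTrace ρ (c * a)) = algebraMap A A' a := by
  simp_rw [coe_invariantTrace, _root_.map_sum, map_mul, ← hρ _ a, ha, ← Finset.sum_mul,
    ← _root_.map_sum, hc, map_one, one_mul]

lemma isLocalizationAway_invariantSubring (r : invariantSubring ρ)
    [IsLocalization.Away (r : A) A'] (hc : ∃ c, ∑ σ, ρ σ c = 1)
    [Algebra (invariantSubring ρ) (invariantSubring ρ')]
    (hmap : ∀ a, (algebraMap (invariantSubring ρ) (invariantSubring ρ') a : A') =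
      algebraMap A A' a) :
    IsLocalization.Away r (invariantSubring ρ') := by
  obtain ⟨c, hc⟩ := hc
  refine ⟨?_, fun z ↦ ?_, fun {a b} hab ↦ ?_⟩
  · rintro ⟨-, n, rfl⟩
    have hr : IsUnit (algebraMap (invariantSubring ρ) (invariantSubring ρ') r) :=
      isUnit_invariantSubring (hmap r ▸ IsLocalization.Away.algebraMap_isUnit (r : A))
    exact map_pow (algebraMap _ (invariantSubring ρ')) r n ▸ hr.pow n
  · obtain ⟨n, a, ha⟩ := IsLocalization.Away.surj (r : A) (z : A')
    have ha_inv (σ : G) : ρ' σ (algebraMap A A' a) = algebraMap A A' a := by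
      have hz : ρ' σ z = z := z.2 σ
      have hr : ρ σ r = r := r.2 σ
      rw [← ha, map_mul, map_pow, hρ, hz, hr]
    refine ⟨(invariantTrace ρ (c * a), ⟨r ^ n, n, rfl⟩), Subtype.ext ?_⟩
    change (z : A') * (algebraMap _ (invariantSubring ρ') (r ^ n) : A') =
      (algebraMap _ (invariantSubring ρ') _ : A')
    rw [hmap, hmap, algebraMap_invariantTrace_mul hρ hc ha_inv, Subring.coe_pow, map_pow, ha]
  · have hab' : algebraMap A A' a = algebraMap A A' b := by rw [← hmap, ← hmap, hab]
    obtain ⟨⟨-, n, rfl⟩, hn⟩ := IsLocalization.exists_of_eq (M := .powers (r : A)) hab'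
    exact ⟨⟨r ^ n, n, rfl⟩, Subtype.ext hn⟩

end localization

end invariants

lemma isPushout_of_basis {l L R A ι : Type*} [CommRing l] [CommRing L] [CommRing R] [CommRing A]
    [Algebra l L] [Algebra l R] [Algebra l A] [Algebra L A] [Algebra R A] [IsScalarTower l L A]
    [IsScalarTower l R A] (b : Module.Basis ι l L) (b' : Module.Basis ι R A)
    (hb : ∀ i, b' i = algebraMap L A (b i)) : Algebra.IsPushout l L R A := by
  let e : TensorProduct l R L ≃ₗ[R] A := (Algebra.TensorProduct.basis R b).equiv b' (.refl _)
  have he : (e.toLinearMap.restrictScalars l) ∘ₗ TensorProduct.mk l R L 1 =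
      (IsScalarTower.toAlgHom l L A).toLinearMap := by
    refine b.ext fun i ↦ ?_
    have hi : e (1 ⊗ₜ b i) = b' i := by
      rw [← Algebra.TensorProduct.basis_apply, Module.Basis.equiv_apply, Equiv.refl_apply]
    exact hi.trans (hb i)
  have : Algebra.IsPushout l R L A := ⟨IsBaseChange.of_equiv e fun x ↦ congr($he x)⟩
  exact this.symm

section galoisField

variable {l L : Type*} [Field l] [Field L] [Algebra l L] [FiniteDimensional l L] [IsGalois l L]

lemma exists_sum_algEquiv_eq_one : ∃ c : L, ∑ σ : L ≃ₐ[l] L, σ c = 1 := by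
  obtain ⟨c, hc⟩ := Algebra.trace_surjective l L 1
  exact ⟨c, by rw [← trace_eq_sum_automorphisms, hc, map_one]⟩

variable {ι : Type*} (b : Module.Basis ι l L)

open scoped Classical in
lemma sum_mul_traceDual [Fintype ι] [DecidableEq ι] (σ : L ≃ₐ[l] L) :
    ∑ i, b i * σ (b.traceDual i) = if σ = 1 then 1 else 0 := by
  let B : Matrix ι (L ≃ₐ[l] L) L := .of fun i σ ↦ σ (b i)
  let D : Matrix (L ≃ₐ[l] L) ι L := .of fun σ i ↦ σ (b.traceDual i)
  have hBD : B * D = 1 := by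
    ext i j
    simp_rw [Matrix.mul_apply, B, D, Matrix.of_apply, ← map_mul]
    rw [← trace_eq_sum_automorphisms, Module.Basis.trace_mul_traceDual, Matrix.one_apply]
    split_ifs <;> simp
  have e : ι ≃ (L ≃ₐ[l] L) := Fintype.equivOfCardEq (by
    rw [← Module.finrank_eq_card_basis b, ← Nat.card_eq_fintype_card,
      IsGalois.card_aut_eq_finrank])
  have hDB : (D * B) σ 1 = (1 : Matrix Gal(L/l) Gal(L/l) L) σ 1 :=
    congr_fun₂ ((Matrix.mul_eq_one_comm_of_equiv e).mp hBD) σ 1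
  simp_rw [Matrix.mul_apply, B, D, Matrix.of_apply, AlgEquiv.one_apply, Matrix.one_apply] at hDB
  simpa only [mul_comm] using hDB

variable {A : Type*} [CommRing A] [Algebra L A] {ρ : (L ≃ₐ[l] L) →* (A →+* A)}
  (hρ : ∀ σ c, ρ σ (algebraMap L A c) = algebraMap L A (σ c))
include hρ

lemma invariantTrace_traceDual_mul [Finite ι] [DecidableEq ι] (i j : ι) :
    invariantTrace ρ (algebraMap L A (b.traceDual j * b i)) = if i = j then 1 else 0 := by
  apply Subtype.ext
  simp_rw [coe_invariantTrace, hρ, ← _root_.map_sum]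
  rw [← trace_eq_sum_automorphisms, Module.Basis.trace_traceDual_mul]
  split_ifs <;> simp

lemma linearIndependent_invariantSubring [Finite ι] :
    LinearIndependent (invariantSubring ρ) fun i ↦ algebraMap L A (b i) := by
  classical
  have := Fintype.ofFinite ι
  rw [Fintype.linearIndependent_iff]
  intro a ha j
  have hj : invariantTrace ρ (algebraMap L A (b.traceDual j) * ∑ i, a i • algebraMap L A (b i)) =
      a j := by
    simp_rw [Finset.mul_sum, mul_smul_comm, ← map_mul, _root_.map_sum, _root_.map_smul,
      invariantTrace_traceDual_mul b hρ]
    simp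
  rw [← hj, ha, mul_zero, map_zero]

lemma sum_invariantTrace_smul [Fintype ι] [DecidableEq ι] (a : A) :
    ∑ i, invariantTrace ρ (algebraMap L A (b.traceDual i) * a) • algebraMap L A (b i) = a := by
  classical
  have hσ (σ : L ≃ₐ[l] L) : ∑ i, algebraMap L A (σ (b.traceDual i)) * ρ σ a *
      algebraMap L A (b i) = if σ = 1 then ρ σ a else 0 := by
    have hmul : ∑ i, algebraMap L A (σ (b.traceDual i)) * ρ σ a * algebraMap L A (b i) =
        algebraMap L A (∑ i, b i * σ (b.traceDual i)) * ρ σ a := by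
      simp_rw [_root_.map_sum, map_mul, Finset.sum_mul]
      exact Finset.sum_congr rfl fun i _ ↦ by ring
    rw [hmul, sum_mul_traceDual]
    split_ifs <;> simp
  simp_rw [Subring.smul_def, coe_invariantTrace, smul_eq_mul, map_mul, hρ, Finset.sum_mul]
  rw [Finset.sum_comm]
  simp_rw [hσ]
  simp

/-- A basis of `L` over `l` is also a basis of an `L`-algebra with a semilinear action of the
Galois group over its invariants. -/
def invariantBasis [Finite ι] : Module.Basis ι (invariantSubring ρ) A :=
  .mk (linearIndependent_invariantSubring b hρ) fun a _ ↦ by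
    classical
    have := Fintype.ofFinite ι
    rw [← sum_invariantTrace_smul b hρ a]
    exact Submodule.sum_mem _ fun i _ ↦ Submodule.smul_mem _ _ (Submodule.subset_span ⟨i, rfl⟩)

theorem isPushout_invariantSubring [Algebra l A] [IsScalarTower l L A]
    [Algebra l (invariantSubring ρ)] [IsScalarTower l (invariantSubring ρ) A] :
    Algebra.IsPushout l L (invariantSubring ρ) A :=
  isPushout_of_basis (Module.finBasis l L) (invariantBasis (Module.finBasis l L) hρ) fun i ↦
    Module.Basis.mk_apply _ _ i

end galoisField

/-! ### Galois descent of schemes that are affine over a base -/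

/-- An action of a group by automorphisms of a scheme `T` over `P`. -/
structure SchemeAction (G : Type*) [Group G] {T P : Scheme.{u}} (f : T ⟶ P) where
  map : G → (T ⟶ T)
  map_one : map 1 = 𝟙 T
  map_mul (σ τ : G) : map (σ * τ) = map σ ≫ map τ
  map_comp (σ : G) : map σ ≫ f = f

lemma appLE_eq_id {T : Scheme.{u}} {t : T ⟶ T} (ht : t = 𝟙 T) (U : T.Opens) (hU : U ≤ t ⁻¹ᵁ U) :
    t.appLE U U hU = 𝟙 _ := by
  subst ht
  rw [Scheme.Hom.appLE, Scheme.Hom.id_app]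
  exact (Category.id_comp _).trans (T.presheaf.map_id _)

lemma exists_glue_of_affineZariskiSite {T P Z : Scheme.{u}} (f : T ⟶ P)
    (g : ∀ U : P.AffineZariskiSite, (f ⁻¹ᵁ U.toOpens).toScheme ⟶ Z)
    (hg : ∀ {U V : P.AffineZariskiSite} (_ : U ≤ V) (h : U.toOpens ≤ V.toOpens),
      T.homOfLE (f.preimage_mono h) ≫ g V = g U) :
    ∃ g' : T ⟶ Z, ∀ U : P.AffineZariskiSite, (f ⁻¹ᵁ U.toOpens).ι ≫ g' = g U := by
  let 𝒰 := (Scheme.AffineZariskiSite.directedCover P).pullback₁ f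
  let e (U : P.AffineZariskiSite) := pullbackRestrictIsoRestrict f U.toOpens
  have he (U : P.AffineZariskiSite) :
      (e U).hom ≫ (f ⁻¹ᵁ U.toOpens).ι = pullback.fst f U.toOpens.ι := by
    simp [e]
  have he_map {U V : P.AffineZariskiSite} (h : U.toOpens ≤ V.toOpens) :
      pullback.map f U.toOpens.ι f V.toOpens.ι (𝟙 T) (P.homOfLE h) (𝟙 P) (by simp) (by simp) ≫
        (e V).hom = (e U).hom ≫ T.homOfLE (f.preimage_mono h) := by
    rw [← cancel_mono (f ⁻¹ᵁ V.toOpens).ι, Category.assoc, Category.assoc, he, T.homOfLE_ι, he]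
    exact (pullback.lift_fst _ _ _).trans (Category.comp_id _)
  let ge (U : P.AffineZariskiSite) : pullback f U.toOpens.ι ⟶ Z := (e U).hom ≫ g U
  have hge {U V : P.AffineZariskiSite} (i : U ⟶ V) :
      pullback.map f U.toOpens.ι f V.toOpens.ι (𝟙 T)
        (P.homOfLE (Scheme.AffineZariskiSite.toOpens_mono i.le)) (𝟙 P) (by simp) (by simp) ≫
          ge V = ge U := by
    rw [← Category.assoc, he_map, Category.assoc,
      hg i.le (Scheme.AffineZariskiSite.toOpens_mono i.le)]
  refine ⟨Scheme.OpenCover.glueMorphismsOfLocallyDirected 𝒰 ge hge, fun U ↦ ?_⟩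
  rw [← cancel_epi (e U).hom, ← Category.assoc, he]
  exact Scheme.OpenCover.map_glueMorphismsOfLocallyDirected 𝒰 ge hge U

lemma le_preimage_top {T S : Scheme.{u}} (π : T ⟶ S) (U : T.Opens) : U ≤ π ⁻¹ᵁ ⊤ := le_top

/-- The constants in the sections of a scheme over an affine scheme. -/
def constHom {T : Scheme.{u}} {R : CommRingCat.{u}} (π : T ⟶ Spec R) (U : T.Opens) : R ⟶ Γ(T, U) :=
  (Scheme.ΓSpecIso R).inv ≫ π.appLE ⊤ U (le_preimage_top π U)

lemma toSpecΓ_comp_specMap_constHom {T : Scheme.{u}} {R : CommRingCat.{u}} (π : T ⟶ Spec R)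
    {U : T.Opens} (hU : IsAffineOpen U) : U.toSpecΓ ≫ Spec.map (constHom π U) = U.ι ≫ π := by
  have h := IsAffineOpen.SpecMap_appLE_fromSpec π (isAffineOpen_top (Spec R)) hU
    (le_preimage_top π U)
  rw [IsAffineOpen.fromSpec_top, Scheme.isoSpec_Spec_inv] at h
  rw [constHom, Spec.map_comp, h, ← Category.assoc, hU.toSpecΓ_fromSpec]

namespace SchemeAction

open Scheme.AffineZariskiSite

variable {G : Type*} [Group G] {T P : Scheme.{u}} {f : T ⟶ P} (s : SchemeAction G f)

lemma preimage_eq (σ : G) (U : P.Opens) : s.map σ ⁻¹ᵁ f ⁻¹ᵁ U = f ⁻¹ᵁ U := by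
  rw [← Scheme.Hom.comp_preimage, s.map_comp]

/-- The action on the sections over the preimage of an open set of the base. -/
def act (U : P.Opens) : G →* (Γ(T, f ⁻¹ᵁ U) →+* Γ(T, f ⁻¹ᵁ U)) where
  toFun σ := ((s.map σ).appLE (f ⁻¹ᵁ U) (f ⁻¹ᵁ U) (s.preimage_eq σ U).ge).hom
  map_one' := congrArg CommRingCat.Hom.hom (appLE_eq_id s.map_one _ _)
  map_mul' σ τ := by
    have h : (s.map (σ * τ)).appLE (f ⁻¹ᵁ U) (f ⁻¹ᵁ U) (s.preimage_eq _ U).ge =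
        (s.map τ).appLE (f ⁻¹ᵁ U) (f ⁻¹ᵁ U) (s.preimage_eq _ U).ge ≫
          (s.map σ).appLE (f ⁻¹ᵁ U) (f ⁻¹ᵁ U) (s.preimage_eq _ U).ge := by
      rw [Scheme.Hom.appLE_comp_appLE]
      simp_rw [s.map_mul]
    exact congrArg CommRingCat.Hom.hom h

lemma act_map {U V : P.Opens} (h : U ≤ V) (σ : G) (a : Γ(T, f ⁻¹ᵁ V)) :
    s.act U σ (T.presheaf.map (homOfLE (f.preimage_mono h)).op a) =
      T.presheaf.map (homOfLE (f.preimage_mono h)).op (s.act V σ a) := by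
  change ((T.presheaf.map (homOfLE (f.preimage_mono h)).op ≫ (s.map σ).appLE _ _ _) a) =
    ((s.map σ).appLE _ _ _ ≫ T.presheaf.map (homOfLE (f.preimage_mono h)).op) a
  rw [Scheme.Hom.map_appLE, Scheme.Hom.appLE_map]

lemma act_app (U : P.Opens) (σ : G) (a : Γ(P, U)) : s.act U σ (f.app U a) = f.app U a := by
  have h : f.appLE U (f ⁻¹ᵁ U) le_rfl ≫ (s.map σ).appLE _ _ (s.preimage_eq σ U).ge =
      f.appLE U (f ⁻¹ᵁ U) le_rfl := by
    rw [Scheme.Hom.appLE_comp_appLE]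
    simp_rw [s.map_comp]
  rw [Scheme.Hom.app_eq_appLE]
  exact congr($h a)

/-- The presheaf of the invariant sections. -/
def invariants : P.Opensᵒᵖ ⥤ CommRingCat.{u} where
  obj U := .of (invariantSubring (s.act U.unop))
  map {V U} i := CommRingCat.ofHom
    ((T.presheaf.map (homOfLE (f.preimage_mono i.unop.le)).op).hom.restrict _ _ fun a ha σ ↦ by
      have ha' : s.act V.unop σ a = a := ha σ
      exact (s.act_map i.unop.le σ a).trans (by rw [ha']))
  map_id U := by
    ext a
    exact congr($(T.presheaf.map_id _) a)
  map_comp i j := by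
    ext a
    exact congr($(T.presheaf.map_comp (homOfLE (f.preimage_mono i.unop.le)).op
      (homOfLE (f.preimage_mono j.unop.le)).op) a)

/-- The sections of the base are invariant. -/
def toInvariants : P.presheaf ⟶ s.invariants where
  app U := CommRingCat.ofHom ((f.app U.unop).hom.codRestrict _ fun a σ ↦ s.act_app U.unop σ a)
  naturality {U V} i := by
    ext x
    exact Subtype.ext congr($(f.naturality i) x)

lemma coequifibered_toInvariants [Fintype G] [QuasiCompact f] [QuasiSeparated f]
    (hs : ∀ U : P.Opens, ∃ c, ∑ σ, s.act U σ c = 1) :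
    ((toOpensFunctor P).op.whiskerLeft s.toInvariants).Coequifibered := by
  refine coequifibered_iff_forall_isLocalizationAway.mpr fun U r ↦ ?_
  let inst : Algebra Γ(T, f ⁻¹ᵁ U.1) Γ(T, f ⁻¹ᵁ P.basicOpen r) :=
    (T.presheaf.map (homOfLE (f.preimage_mono (P.basicOpen_le r))).op).hom.toAlgebra
  have hloc : IsLocalization.Away (f.app U.1 r) Γ(T, f ⁻¹ᵁ P.basicOpen r) := by
    let : Algebra Γ(T, f ⁻¹ᵁ U.1) Γ(T, T.basicOpen (f.app _ r)) :=
      (T.presheaf.map (homOfLE (T.basicOpen_le _)).op).hom.toAlgebra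
    dsimp +instances [inst]
    rw! (castMode := .all) [f.preimage_basicOpen r]
    exact isLocalization_basicOpen_of_qcqs (f.isCompact_preimage U.2.isCompact)
        (f.isQuasiSeparated_preimage U.2.isQuasiSeparated) (f.app _ r)
  let : Algebra (invariantSubring (s.act U.1)) (invariantSubring (s.act (P.basicOpen r))) :=
    (s.invariants.map (homOfLE (P.basicOpen_le r)).op).hom.toAlgebra
  let r' : invariantSubring (s.act U.1) := s.toInvariants.app (.op U.1) r
  have : IsLocalization.Away (r' : Γ(T, f ⁻¹ᵁ U.1)) Γ(T, f ⁻¹ᵁ P.basicOpen r) := hloc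
  exact isLocalizationAway_invariantSubring (fun σ a ↦ s.act_map (P.basicOpen_le r) σ a) r'
    (hs U.1) fun a ↦ rfl

/-- The spectrum of the invariant sections over an open set of the base. -/
abbrev specInvariants (U : P.Opens) : Scheme.{u} :=
  Spec (s.invariants.obj (.op U))

/-- The inclusion of the invariant sections into the sections. -/
def invariantsSubtype (U : P.Opens) : s.invariants.obj (.op U) ⟶ Γ(T, f ⁻¹ᵁ U) :=
  CommRingCat.ofHom (invariantSubring (s.act U)).subtype

/-- The canonical morphism from the preimage of an open set of the base to the spectrum of the
invariant sections over it. -/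
def toSpecInvariants (U : P.Opens) : (f ⁻¹ᵁ U).toScheme ⟶ s.specInvariants U :=
  (f ⁻¹ᵁ U).toSpecΓ ≫ Spec.map (s.invariantsSubtype U)

lemma homOfLE_comp_toSpecInvariants {U V : P.Opens} (h : U ≤ V) :
    T.homOfLE (f.preimage_mono h) ≫ s.toSpecInvariants V =
      s.toSpecInvariants U ≫ Spec.map (s.invariants.map (homOfLE h).op) := by
  have hres : Spec.map (T.presheaf.map (homOfLE (f.preimage_mono h)).op) ≫
      Spec.map (s.invariantsSubtype V) =
      Spec.map (s.invariantsSubtype U) ≫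
        Spec.map (s.invariants.map (homOfLE h).op) :=
    (Spec.map_comp _ _).symm.trans (Spec.map_comp (s.invariants.map (homOfLE h).op)
      (s.invariantsSubtype U))
  rw [toSpecInvariants, ← Scheme.Opens.toSpecΓ_SpecMap_presheaf_map_assoc, hres, toSpecInvariants,
    Category.assoc]

lemma toSpecInvariants_comp_specMap_comp_fromSpec {U : P.Opens} (hU : IsAffineOpen U) :
    s.toSpecInvariants U ≫ Spec.map (s.toInvariants.app (.op U)) ≫ hU.fromSpec =
      (f ⁻¹ᵁ U).ι ≫ f := by
  have hcomp : Spec.map (s.invariantsSubtype U) ≫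
      Spec.map (s.toInvariants.app (.op U)) = Spec.map (f.app U) :=
    (Spec.map_comp _ _).symm
  rw [toSpecInvariants, Category.assoc, reassoc_of% hcomp]
  simp

lemma exists_quotient (hs : ((toOpensFunctor P).op.whiskerLeft s.toInvariants).Coequifibered) :
    ∃ (T₀ : Scheme.{u}) (g : T ⟶ T₀) (q : T₀ ⟶ P)
      (ι : ∀ U : P.AffineZariskiSite, s.specInvariants U.toOpens ⟶ T₀), g ≫ q = f ∧
      (∀ U, IsOpenImmersion (ι U)) ∧ (∀ U, Set.range (ι U) = q ⁻¹' (U.toOpens : Set P)) ∧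
      ∀ U, (f ⁻¹ᵁ U.toOpens).ι ≫ g = s.toSpecInvariants U.toOpens ≫ ι U := by
  let d : (directedCover P).RelativeGluingData := relativeGluingData hs
  have : (d.functor ⋙ Scheme.forget).IsLocallyDirected :=
    Scheme.Cover.RelativeGluingData.instIsLocallyDirectedI₀CompFunctorForgetOfIsThin ..
  let ι (U : P.AffineZariskiSite) : s.specInvariants U.toOpens ⟶ d.glued := colimit.ι d.functor U
  have hι_map {U V : P.AffineZariskiSite} (hUV : U ≤ V) (h : U.toOpens ≤ V.toOpens) :
      Spec.map (s.invariants.map (homOfLE h).op) ≫ ι V = ι U :=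
    colimit.w d.functor (homOfLE hUV)
  have hι_base (U : P.AffineZariskiSite) :
      ι U ≫ d.toBase = Spec.map (s.toInvariants.app (.op U.toOpens)) ≫ U.2.fromSpec :=
    colimit.ι_desc _ _
  obtain ⟨g, hg⟩ := exists_glue_of_affineZariskiSite f
    (fun U ↦ s.toSpecInvariants U.toOpens ≫ ι U) fun {U V} hUV h ↦ by
      rw [← Category.assoc, s.homOfLE_comp_toSpecInvariants h, Category.assoc, hι_map hUV h]
  refine ⟨d.glued, g, d.toBase, ι, ?_, fun U ↦ d.cover.map_prop U, fun U ↦ ?_, hg⟩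
  · refine Scheme.Cover.hom_ext (T.openCoverOfIsOpenCover _
      (.comap (iSup_affineOpens_eq_top P) f.base.1)) _ _ fun (U : P.AffineZariskiSite) ↦ ?_
    change (f ⁻¹ᵁ U.toOpens).ι ≫ g ≫ d.toBase = (f ⁻¹ᵁ U.toOpens).ι ≫ f
    rw [← Category.assoc, hg, Category.assoc, hι_base]
    exact s.toSpecInvariants_comp_specMap_comp_fromSpec U.2
  · refine (d.preimage_toBase_eq_range_ι U).symm.trans (congrArg (d.toBase ⁻¹' ·) ?_)
    exact Scheme.Opens.range_ι _

section galois

variable {l L : Type u} [Field l] [Field L] [Algebra l L] {s : SchemeAction (L ≃ₐ[l] L) f}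
  {π : T ⟶ Spec (.of L)}
  (hπ : ∀ σ, s.map σ ≫ π = π ≫ Spec.map (CommRingCat.ofHom (σ : L →+* L)))
include hπ

lemma act_constHom (U : P.Opens) (σ : L ≃ₐ[l] L) (c : L) :
    s.act U σ (constHom π (f ⁻¹ᵁ U) c) = constHom π (f ⁻¹ᵁ U) (σ c) := by
  have h : constHom π (f ⁻¹ᵁ U) ≫ (s.map σ).appLE _ _ (s.preimage_eq σ U).ge =
      CommRingCat.ofHom (σ : L →+* L) ≫ constHom π (f ⁻¹ᵁ U) := by
    rw [constHom, Category.assoc, Scheme.Hom.appLE_comp_appLE, Scheme.ΓSpecIso_inv_naturality_assoc]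
    simp_rw [hπ]
    rw [Scheme.Hom.comp_appLE]
    rfl
  exact congr($h c)

variable [FiniteDimensional l L] [IsGalois l L]

lemma isPullback_toSpecInvariants {U : P.Opens} (hU : IsAffineOpen (f ⁻¹ᵁ U))
    {t : s.specInvariants U ⟶ Spec (.of l)}
    (ht : s.toSpecInvariants U ≫ t =
      (f ⁻¹ᵁ U).ι ≫ π ≫ Spec.map (CommRingCat.ofHom (algebraMap l L))) :
    IsPullback (s.toSpecInvariants U) ((f ⁻¹ᵁ U).ι ≫ π) t
      (Spec.map (CommRingCat.ofHom (algebraMap l L))) := by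
  have hiso : IsIso (f ⁻¹ᵁ U).toSpecΓ := inferInstanceAs (IsIso hU.isoSpec.hom)
  obtain ⟨γ, rfl⟩ := Spec.map_surjective t
  have hγ : γ ≫ s.invariantsSubtype U =
      CommRingCat.ofHom (algebraMap l L) ≫ constHom π (f ⁻¹ᵁ U) := by
    apply Spec.map_injective
    rw [← cancel_epi (f ⁻¹ᵁ U).toSpecΓ, Spec.map_comp, Spec.map_comp, ← Category.assoc,
      ← Category.assoc _ (Spec.map (constHom _ _)), toSpecΓ_comp_specMap_constHom π hU,
      Category.assoc]
    exact ht
  rw [← toSpecΓ_comp_specMap_constHom π hU]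
  let := (constHom π (f ⁻¹ᵁ U)).hom.toAlgebra
  let : Algebra l (invariantSubring (s.act U)) := γ.hom.toAlgebra
  let := (CommRingCat.ofHom (algebraMap l L) ≫ constHom π (f ⁻¹ᵁ U)).hom.toAlgebra
  have : IsScalarTower l L Γ(T, f ⁻¹ᵁ U) := .of_algebraMap_eq' rfl
  have : IsScalarTower l (invariantSubring (s.act U)) Γ(T, f ⁻¹ᵁ U) :=
    .of_algebraMap_eq' congr($(hγ).hom).symm
  have := isPushout_invariantSubring (act_constHom hπ U)
  have hSpec := isPullback_SpecMap_of_isPushout _ _ _ _ (CommRingCat.isPushout_of_isPushout l L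
    (invariantSubring (s.act U)) Γ(T, f ⁻¹ᵁ U))
  exact hSpec.flip.of_iso (asIso (f ⁻¹ᵁ U).toSpecΓ).symm (Iso.refl _) (Iso.refl _)
    (Iso.refl _) (by simp [toSpecInvariants]; rfl) (by simp; rfl) (by simp; rfl) (by simp)

theorem exists_isPullback [IsAffineHom f] {p : P ⟶ Spec (.of l)}
    (hp : f ≫ p = π ≫ Spec.map (CommRingCat.ofHom (algebraMap l L))) :
    ∃ (T₀ : Scheme.{u}) (g : T ⟶ T₀) (q : T₀ ⟶ P), g ≫ q = f ∧
      IsPullback g π (q ≫ p) (Spec.map (CommRingCat.ofHom (algebraMap l L))) := by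
  have hs : ((toOpensFunctor P).op.whiskerLeft s.toInvariants).Coequifibered := by
    obtain ⟨c, hc⟩ := exists_sum_algEquiv_eq_one (l := l) (L := L)
    refine s.coequifibered_toInvariants fun U ↦ ⟨constHom π (f ⁻¹ᵁ U) c, ?_⟩
    simp_rw [act_constHom hπ, ← _root_.map_sum, hc, _root_.map_one]
  obtain ⟨T₀, g, q, ι, hgq, hι, hrange, hg⟩ := s.exists_quotient hs
  refine ⟨T₀, g, q, hgq, ?_⟩
  let 𝒰 : T₀.OpenCover := Scheme.Cover.mkOfCovers P.AffineZariskiSite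
    (fun U ↦ s.specInvariants U.toOpens) ι (fun x ↦ by
      obtain ⟨U, hU, hxU, -⟩ := exists_isAffineOpen_mem_and_subset (x := q x) (U := ⊤) trivial
      obtain ⟨y, hy⟩ := (hrange ⟨U, hU⟩).ge hxU
      exact ⟨⟨U, hU⟩, y, hy⟩) hι
  refine isPullback_of_openCover_of_isPullback 𝒰
    (fun U : P.AffineZariskiSite ↦ (f ⁻¹ᵁ U.toOpens).ι) (fun U ↦ s.toSpecInvariants U.toOpens)
    (fun (U : P.AffineZariskiSite) ↦ ?_)
    fun (U : P.AffineZariskiSite) ↦ isPullback_toSpecInvariants hπ (U.2.preimage f) ?_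
  · have := hι U
    refine (IsOpenImmersion.isPullback (s.toSpecInvariants U.toOpens) (f ⁻¹ᵁ U.toOpens).ι (ι U) g
      (hg U) (TopologicalSpace.Opens.ext ?_)).flip
    rw [Scheme.Opens.opensRange_ι]
    change g ⁻¹' (Set.range (ι U)) = _
    rw [hrange, ← hgq]
    rfl
  · change s.toSpecInvariants U.toOpens ≫ ι U ≫ q ≫ p = _
    rw [← Category.assoc, ← hg, Category.assoc, reassoc_of% hgq, hp]

end galois

end SchemeAction

/-! ### Covers of curves are finite -/

section curve

variable {T : Scheme.{u}} [IrreducibleSpace T]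

lemma topologicalKrullDim_eq_one_iff :
    topologicalKrullDim T = 1 ↔ (∃ x : T, x ≠ genericPoint T) ∧
      ∀ x y : T, x ⤳ y → x = genericPoint T ∨ x = y := by
  let : PartialOrder T := specializationOrder T
  have hdim : topologicalKrullDim T = Order.krullDim T :=
    Order.krullDim_eq_of_orderIso irreducibleSetEquivPoints
  have hle (x y : T) : x ≤ y ↔ y ⤳ x := Iff.rfl
  rw [hdim, le_antisymm_iff, Order.krullDim_le_one_iff, Order.one_le_krullDim_iff, and_comm]
  refine and_congr ⟨?_, ?_⟩ ⟨?_, ?_⟩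
  · rintro ⟨x, y, hxy⟩
    refine ⟨x, ?_⟩
    rintro rfl
    exact hxy.not_ge (genericPoint_specializes y)
  · rintro ⟨x, hx⟩
    exact ⟨x, genericPoint T, lt_of_le_of_ne (genericPoint_specializes x) hx⟩
  · intro h x y hxy
    rcases h x with hmin | hmax
    · exact .inr (((hle y x).mpr hxy).antisymm (hmin hxy)).symm
    · exact .inl (le_antisymm (genericPoint_specializes x) (hmax (genericPoint_specializes x)))
  · intro h x
    refine or_iff_not_imp_right.mpr fun hx y hy ↦ ?_
    rcases h x y hy with rfl | rfl
    · exact absurd (fun y _ ↦ genericPoint_specializes y) hx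
    · exact le_rfl

lemma eq_of_specializes_of_ne_genericPoint (hT : topologicalKrullDim T = 1) {x y : T}
    (hxy : x ⤳ y) (hx : x ≠ genericPoint T) : x = y :=
  ((topologicalKrullDim_eq_one_iff.mp hT).2 x y hxy).resolve_left hx

lemma isClosed_singleton_of_ne_genericPoint (hT : topologicalKrullDim T = 1) {x : T}
    (hx : x ≠ genericPoint T) : IsClosed {x} :=
  isClosed_of_closure_subset fun _ hy ↦
    (eq_of_specializes_of_ne_genericPoint hT (specializes_iff_mem_closure.mpr hy) hx).symm

lemma finite_of_isClosed_of_genericPoint_notMem [TopologicalSpace.NoetherianSpace T]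
    (hT : topologicalKrullDim T = 1) {Z : Set T} (hZ : IsClosed Z) (hη : genericPoint T ∉ Z) :
    Z.Finite := by
  obtain ⟨S, hirr, hsup⟩ := TopologicalSpace.NoetherianSpace.exists_finset_irreducible
    (⟨Z, hZ⟩ : TopologicalSpace.Closeds T)
  have hZS : Z = ⋃ W ∈ S, (W : Set T) := by
    have h := TopologicalSpace.Closeds.coe_finset_sup id S
    rwa [← hsup, Finset.sup_set_eq_biUnion] at h
  rw [hZS]
  refine S.finite_toSet.biUnion fun W hW ↦ ?_
  obtain ⟨z, hz⟩ := QuasiSober.sober (hirr ⟨W, hW⟩) W.isClosed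
  have hzη : z ≠ genericPoint T := by
    rintro rfl
    exact hη (hZS ▸ Set.mem_biUnion hW hz.mem)
  exact (Set.finite_singleton z).subset fun y hy ↦
    (eq_of_specializes_of_ne_genericPoint hT (hz.specializes hy) hzη).symm

variable {P : Scheme.{u}} {f : T ⟶ P} [IsProper f]

lemma preimage_genericPoint_subset_of_not_subsingleton_range (hT : topologicalKrullDim T = 1)
    (hf : ¬ (Set.range f).Subsingleton) :
    f ⁻¹' {f (genericPoint T)} ⊆ {genericPoint T} := by
  intro x hx
  by_contra hne
  have hclosed : IsClosed {f (genericPoint T)} := by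
    have himage := f.isClosedMap _ (isClosed_singleton_of_ne_genericPoint hT hne)
    rwa [Set.image_singleton, hx] at himage
  have hconst (y : T) : f y = f (genericPoint T) :=
    (genericPoint_specializes y).mem_closed (hclosed.preimage f.continuous) rfl
  refine hf ?_
  rintro _ ⟨y, rfl⟩ _ ⟨z, rfl⟩
  rw [hconst, hconst z]

lemma isFinite_of_not_subsingleton_range [TopologicalSpace.NoetherianSpace T]
    (hT : topologicalKrullDim T = 1) (hf : ¬ (Set.range f).Subsingleton) : IsFinite f := by
  suffices LocallyQuasiFinite f from .of_isProper_of_locallyQuasiFinite f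
  rw [locallyQuasiFinite_iff_finite_preimage_singleton]
  intro y
  by_cases hy : f (genericPoint T) = y
  · rw [← hy]
    exact (Set.finite_singleton _).subset
      (preimage_genericPoint_subset_of_not_subsingleton_range hT hf)
  rcases (f ⁻¹' {y}).eq_empty_or_nonempty with hempty | ⟨t, rfl⟩
  · rw [hempty]
    exact Set.finite_empty
  · refine (finite_of_isClosed_of_genericPoint_notMem hT
      (isClosed_closure.preimage f.continuous) fun hη ↦ hy ?_).subset
        (Set.preimage_mono subset_closure)
    exact (((genericPoint_specializes t).map f.continuous).antisymm
      (specializes_iff_mem_closure.mpr hη)).eq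

end curve

lemma Family.IsAdmissible.isFinite_toProd {k l : Type u} [Field k] [Field l] [Algebra k l]
    {κ : Kind k} (hκ : κ ≠ .variety) {T : Family κ (specOver k l)} (hT : T.IsAdmissible) :
    IsFinite T.toProd := by
  cases κ with
  | variety => exact (hκ rfl).elim
  | cover C hC =>
    obtain ⟨hcurve, hnonconst⟩ := hT
    let π : T.T ⟶ Spec (.of l) := T.π
    obtain ⟨_, hproper, hint, hdim⟩ :=
      (isSmoothProjectiveCurve_iff_topologicalKrullDim (π := π)).mp hcurve
    have := irreducibleSpace_of_geometricallyIntegral π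
    have : IsLocallyNoetherian T.T := LocallyOfFiniteType.isLocallyNoetherian π
    have : CompactSpace T.T := (quasiCompact_iff_compactSpace π).mp inferInstance
    have : IsNoetherian T.T := {}
    have hsep : IsSeparated (pullback.snd (Kind.cover C hC).base.hom (specOver k l).hom) :=
      have : IsSeparated C.hom := hC.proper.toIsSeparated
      inferInstanceAs (IsSeparated (pullback.snd C.hom (specOver k l).hom))
    have hcomp : IsProper (T.toProd ≫ pullback.snd _ _) := T.toProd_snd ▸ hproper
    have : IsProper T.toProd := IsProper.of_comp _ (pullback.snd _ _)
    exact isFinite_of_not_subsingleton_range hdim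
      ((forall_not_subsingleton_image_iff (π := π) T.toProd).mp hnonconst)

/-! ### Galois descent of families that are affine over the base of their kind -/

namespace Family

variable {k : Type u} [Field k] {κ : Kind k}

lemma prodMap_fst {S S' : Over (Spec (.of k))} (f : S ⟶ S') :
    prodMap κ f ≫ pullback.fst κ.base.hom S'.hom = pullback.fst κ.base.hom S.hom :=
  pullback.lift_fst _ _ _

lemma prodMap_comp {S S' S'' : Over (Spec (.of k))} (f : S ⟶ S') (g : S' ⟶ S'') :
    prodMap κ (f ≫ g) = prodMap κ f ≫ prodMap κ g := by
  apply pullback.hom_ext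
  · rw [Category.assoc, prodMap_fst, prodMap_fst, prodMap_fst]
  · rw [Category.assoc, (isPullback_prodMap κ _).w, (isPullback_prodMap κ _).w,
      (isPullback_prodMap κ _).w_assoc, Over.comp_left]

variable {l L : Type u} [Field l] [Field L] [Algebra k l] [Algebra k L] [Algebra l L]
  [IsScalarTower k l L] [FiniteDimensional l L] [IsGalois l L]

theorem exists_cartHom_of_isGalois {T : Family κ (specOver k L)} [IsAffineHom T.toProd]
    (s : ∀ σ : L ≃ₐ[l] L, T.CartHom T (specOverMap (σ.restrictScalars k : L →ₐ[k] L)))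
    (hs_one : (s 1).top = 𝟙 _) (hs_mul : ∀ σ τ, (s (σ * τ)).top = (s σ).top ≫ (s τ).top) :
    ∃ T₀ : Family κ (specOver k l), Nonempty (T.CartHom T₀ (specOverExt k l L)) := by
  have hv : IsAffineHom (specOverExt k l L).left :=
    inferInstanceAs (IsAffineHom (Spec.map (CommRingCat.ofHom (algebraMap l L))))
  have : IsAffineHom (prodMap κ (specOverExt k l L)) :=
    MorphismProperty.of_isPullback (isPullback_prodMap κ _).flip hv
  have hσ (σ : L ≃ₐ[l] L) : specOverMap (σ.restrictScalars k : L →ₐ[k] L) ≫ specOverExt k l L =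
      specOverExt k l L := by
    rw [specOverMap_comp]
    exact congrArg specOverMap (AlgHom.ext σ.commutes)
  let A : SchemeAction (L ≃ₐ[l] L) (T.toProd ≫ prodMap κ (specOverExt k l L)) :=
    { map σ := (s σ).top
      map_one := hs_one
      map_mul := hs_mul
      map_comp σ := by
        rw [← Category.assoc, ← (s σ).toProd_comp_prodMap, Category.assoc, ← prodMap_comp, hσ] }
  have hπ : (T.toProd ≫ prodMap κ (specOverExt k l L)) ≫ pullback.snd _ _ =
      T.π ≫ (specOverExt k l L).left := by
    rw [Category.assoc, (isPullback_prodMap κ _).w, ← Category.assoc, T.toProd_snd]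
  obtain ⟨T₀, g, q, hgq, hg⟩ := A.exists_isPullback (π := T.π) (fun σ ↦ (s σ).isPullback.w)
    (p := pullback.snd κ.base.hom (specOver k l).hom) hπ
  refine ⟨⟨T₀, q ≫ pullback.snd _ _, q ≫ pullback.fst _ _, ?_⟩, ⟨g, hg, ?_⟩⟩
  · rw [Category.assoc, Category.assoc, pullback.condition]
  · change g ≫ q ≫ pullback.fst _ _ = _
    rw [← Category.assoc, hgq, Category.assoc, prodMap_fst, T.toProd_fst]

end Family

/-! ### Descent of models along fully faithful functors -/

namespace DescentObject

variable {k K : Type u} [Field k] [Field K] [Algebra k K] {X Y : DescentObject k K}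

lemma Model.exists_hom_of_cartHom {M N : X.Model} {U V : FEt k} (hM : M.U = U) (hN : N.U = V)
    (g : U ⟶ V) (a : (M.familyOn hM).CartHom (N.familyOn hN) (FEt.homToOver g)) :
    ∃ f : M ⟶ N, X.proj.IsHomLift g f := by
  subst hM hN
  let f : M ⟶ N := ⟨g, a.top, a.isPullback, a.top_φ⟩
  exact ⟨f, Functor.IsHomLift.map (p := X.proj) f⟩

lemma isStronglyCartesian_proj {M N : X.Model} {U V : FEt k} (g : U ⟶ V) (f : M ⟶ N)
    [hf : X.proj.IsHomLift g f] : X.proj.IsStronglyCartesian g f := by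
  obtain rfl : M.U = U := CategoryTheory.IsHomLift.domain_eq X.proj g f
  obtain rfl : N.U = V := CategoryTheory.IsHomLift.codomain_eq X.proj g f
  obtain rfl : g = X.proj.map f :=
    @CategoryTheory.IsHomLift.eq_of_isHomLift _ _ _ _ X.proj M N g f hf
  refine ⟨fun {M'} h φ hφ ↦ ?_⟩
  have hbase : h ≫ f.base = φ.base :=
    @CategoryTheory.IsHomLift.eq_of_isHomLift _ _ _ _ X.proj M' N (h ≫ f.base) φ hφ
  let a : M'.family.CartHom N.family (FEt.homToOver φ.base) := ⟨φ.top, φ.isPullback, φ.top_φ⟩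
  let b : M.family.CartHom N.family (FEt.homToOver f.base) := ⟨f.top, f.isPullback, f.top_φ⟩
  let c : M'.family.CartHom M.family (FEt.homToOver h) := a.lift b (congrArg FEt.homToOver hbase)
  have hc : c.top ≫ f.top = φ.top := a.lift_top_comp_top b (congrArg FEt.homToOver hbase)
  let χ : M' ⟶ M := ⟨h, c.top, c.isPullback, c.top_φ⟩
  refine ⟨χ, ⟨Functor.IsHomLift.map (p := X.proj) χ, Model.Hom.ext hbase hc⟩, ?_⟩
  rintro χ' ⟨hχ', hcomp⟩
  obtain rfl : h = χ'.base :=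
    @CategoryTheory.IsHomLift.eq_of_isHomLift _ _ _ _ X.proj M' M h χ' hχ'
  refine Model.Hom.ext rfl (f.isPullback.hom_ext ?_ ?_)
  · exact congr(Model.Hom.top $hcomp).trans hc.symm
  · exact χ'.isPullback.w.trans c.isPullback.w.symm

lemma isCartesianFunctor (F : BasedFunctor X.models Y.models) : FibStack.IsCartesianFunctor F :=
  fun f _ _ c _ ↦
    have := F.preserves_isHomLift f c
    isStronglyCartesian_proj f (F.map c)

lemma exists_cartHom_map_of_normal [IsGalois k K] (F : BasedFunctor X.models Y.models)
    {l : Type u} [Field l] [Algebra k l] [FiniteDimensional k l] {y : Family Y.kind (specOver k l)}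
    (hy : Y.IsForm y) :
    ∃ (L : IntermediateField k K) (_ : FiniteDimensional k L) (_ : Normal k L) (i : l →ₐ[k] L)
      (T : Family X.kind (specOver k L)) (hT : X.IsForm T),
      Nonempty ((hT.map F).CartHom y (specOverMap i)) := by
  obtain ⟨e, ⟨a⟩⟩ := hy
  obtain ⟨E, M, ⟨aM⟩⟩ := X.exists_cartHom_finSub
  have := E.2
  have hM : X.IsForm M := ⟨_, ⟨aM⟩⟩
  obtain ⟨g, ⟨b⟩⟩ := hM.isForm_map F
  obtain ⟨G, N, f, f', -, -, -, ⟨n⟩, ⟨n'⟩⟩ := exists_common_form a b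
  have := G.2
  let L : IntermediateField k K := IntermediateField.normalClosure k G.1 K
  have hL : FiniteDimensional k L := normalClosure.is_finiteDimensional k G.1 K
  have hLn : Normal k L := normalClosure.normal k G.1 K
  let ι : G.1 →ₐ[k] L := IntermediateField.inclusion G.1.le_normalClosure
  let h : E.1 →ₐ[k] L := ι.comp f'
  obtain ⟨ρ, hρ⟩ := exists_algEquiv_comp_eq (L.val.comp h) E.1.val
  let T : Family X.kind (specOver k L) := M.baseChange (specOverMap h)
  have hT : X.IsForm T := ⟨(ρ : K →ₐ[k] K).comp L.val,
    ⟨aM.lift (M.baseChangeHom _) ((specOverMap_comp _ _).trans (congrArg _ hρ))⟩⟩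
  obtain ⟨m⟩ := hT.nonempty_cartHom_map F hM (M.baseChangeHom (specOverMap h))
  let d : (hT.map F).CartHom N (specOverMap ι) := m.lift n' (specOverMap_comp _ _)
  exact ⟨L, hL, hLn, ι.comp f, T, hT, ⟨(d.comp n).cast (specOverMap_comp _ _)⟩⟩

section descent

variable (F : BasedFunctor X.models Y.models) [F.toFunctor.Full] [F.toFunctor.Faithful]
  {l L : Type u} [Field l] [Algebra k l] [FiniteDimensional k l] [Algebra.IsSeparable k l]
  [Field L] [Algebra k L] [FiniteDimensional k L] [Algebra.IsSeparable k L]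

lemma exists_isForm_of_isStack (hX : FibStack.IsStack (FEt.topology k) X.models) (i : l →ₐ[k] L)
    {m : X.Model} (hm : m.U = FEt.ofField k L) {y : Y.Model} (j : F.obj m ⟶ y)
    (hj : Y.proj.IsHomLift (R := FEt.ofField k L) (S := FEt.ofField k l) (specOverMap i) j) :
    ∃ T : Family X.kind (specOver k l), X.IsForm T := by
  let q : FEt.ofField k L ⟶ FEt.ofField k l := specOverMap i
  let R : Sieve (FEt.ofField k l) := Sieve.generateSingleton q
  have hR : R ∈ FEt.topology k (FEt.ofField k l) := fun x ↦
    ⟨FEt.ofField k L, q, Classical.arbitrary (PrimeSpectrum L),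
      ⟨𝟙 _, Category.id_comp q⟩,
      Subsingleton.elim (α := PrimeSpectrum l) _ _⟩
  have := hX.isFibered
  obtain ⟨D, -⟩ := FibStack.exists_descentDatum_image_cartesianCocone F (isCartesianFunctor F) R y
    (by
      rintro V _ ⟨g, rfl⟩
      obtain ⟨x, c, hc⟩ := IsPreFibered.exists_isCartesian X.proj hm g
      have : Y.proj.IsHomLift g (F.map c) := F.preserves_isHomLift g c
      have : Y.proj.IsHomLift (g ≫ q) (F.map c ≫ j) := inferInstance
      exact ⟨x, F.map c ≫ j, isStronglyCartesian_proj _ _⟩)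
  obtain ⟨x, -, hx, -⟩ := hX.isEffective R hR D
  obtain ⟨g, hg⟩ := Model.exists_cartHom_familyOn x (U := FEt.ofField k l) hx
    (Classical.arbitrary (PrimeSpectrum l))
  obtain ⟨e, rfl⟩ := exists_eq_specOverMap g
  exact ⟨_, e, hg⟩

lemma exists_isForm_of_isGalois [Algebra.IsAlgebraic k K] [Algebra l L] [IsScalarTower k l L]
    [IsGalois l L] (hX : X.kind ≠ .variety) {T : Family X.kind (specOver k L)} (hT : X.IsForm T)
    {y : Y.Model} (j : F.obj hT.model ⟶ y)
    (hj : Y.proj.IsHomLift (R := FEt.ofField k L) (S := FEt.ofField k l) (specOverExt k l L) j) :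
    ∃ T₀ : Family X.kind (specOver k l), X.IsForm T₀ := by
  have := FiniteDimensional.right k l L
  let q : FEt.ofField k L ⟶ FEt.ofField k l := specOverExt k l L
  have : Y.proj.IsStronglyCartesian q j := isStronglyCartesian_proj _ _
  let b (σ : L ≃ₐ[l] L) : FEt.ofField k L ⟶ FEt.ofField k L :=
    specOverMap (σ.restrictScalars k : L →ₐ[k] L)
  obtain ⟨s, hs, hs_one, hs_mul⟩ := FibStack.exists_action_isHomLift F q j b
    (fun σ ↦ (specOverMap_comp _ _).trans (congrArg _ (AlgHom.ext σ.commutes)))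
    (Over.OverMorphism.ext (Spec.map_id _))
    (fun σ τ ↦ Over.OverMorphism.ext
      (Spec.map_comp (CommRingCat.ofHom (τ : L →+* L)) (CommRingCat.ofHom (σ : L →+* L))))
  have hbase (σ) : b σ = (s σ).base :=
    @CategoryTheory.IsHomLift.eq_of_isHomLift _ _ _ _ X.proj hT.model hT.model (b σ) (s σ) (hs σ)
  have hpullback (σ) : IsPullback (s σ).top T.π T.π (FEt.homToOver (b σ)).left := by
    rw [hbase σ]
    exact (s σ).isPullback
  have := Family.IsAdmissible.isFinite_toProd hX hT.isAdmissible
  obtain ⟨T₀, ⟨d⟩⟩ := Family.exists_cartHom_of_isGalois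
    (fun σ ↦ (⟨(s σ).top, hpullback σ, (s σ).top_φ⟩ : T.CartHom T _))
    congr(Model.Hom.top $hs_one) (fun σ τ ↦ congr(Model.Hom.top $(hs_mul σ τ)))
  obtain ⟨e, ⟨a⟩⟩ := hT
  exact ⟨T₀, e.comp (IsScalarTower.toAlgHom k l L), ⟨(a.comp d).cast (specOverMap_comp _ _)⟩⟩

end descent

section galois

variable [IsGalois k K] (F : BasedFunctor X.models Y.models)

lemma HasModelOver.of_map (hX : X.kind = .variety → FibStack.IsStack (FEt.topology k) X.models)
    [F.toFunctor.Full] [F.toFunctor.Faithful] {l : IntermediateField k K}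
    (h : Y.HasModelOver l) : X.HasModelOver l := by
  obtain ⟨E, y, hy⟩ := h.exists_isForm
  have := E.2
  have : Algebra.IsSeparable k l := inferInstance
  obtain ⟨L, _, _, i, T, hT, ⟨d⟩⟩ := exists_cartHom_map_of_normal F hy
  obtain ⟨j, hj⟩ := Model.exists_hom_of_cartHom (M := F.obj hT.model) (N := hy.model)
    (U := FEt.ofField k L) (V := FEt.ofField k E.1) (F.w_obj hT.model) rfl (specOverMap i) d
  obtain ⟨x, hx⟩ : ∃ x : Family X.kind (specOver k E.1), X.IsForm x := by
    by_cases hv : X.kind = .variety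
    · exact exists_isForm_of_isStack F (hX hv) i rfl j hj
    · let := i.toRingHom.toAlgebra
      have : IsScalarTower k E.1 L := .of_algebraMap_eq' i.comp_algebraMap.symm
      have : IsGalois k L := {}
      have : IsGalois E.1 L := IsGalois.tower_top_of_isGalois k E.1 L
      exact exists_isForm_of_isGalois F hv hT j hj
  exact hx.hasModelOver

include F in
lemma HasFieldOfModuli.isFieldOfDefinition_map (hX : X.HasFieldOfModuli) {l : IntermediateField k K}
    (h : X.IsFieldOfDefinition l) : Y.IsFieldOfDefinition l :=
  (hX.map F).isFieldOfDefinition (HasModelOver.map F ⟨_, h⟩)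

lemma HasFieldOfModuli.isFieldOfDefinition_iff (hX : X.HasFieldOfModuli)
    (hstack : X.kind = .variety → FibStack.IsStack (FEt.topology k) X.models)
    [F.toFunctor.Full] [F.toFunctor.Faithful] (l : IntermediateField k K) :
    X.IsFieldOfDefinition l ↔ Y.IsFieldOfDefinition l :=
  ⟨hX.isFieldOfDefinition_map F,
    fun h ↦ hX.isFieldOfDefinition (HasModelOver.of_map F hstack ⟨_, h⟩)⟩

end galois

end DescentObject

end

theorem mainTheorem8_general {k K : Type u} [Field k] [Field K] [Algebra k K] [IsGalois k K] :
    (∀ (X Y : DescentObject k K) (F : BasedFunctor X.models Y.models),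
      (X.HasFieldOfModuli → Y.HasFieldOfModuli) ∧
      (∀ l : IntermediateField k K, X.HasModelOver l → Y.HasModelOver l) ∧
      (X.HasFieldOfModuli →
        ∀ l : IntermediateField k K, X.IsFieldOfDefinition l → Y.IsFieldOfDefinition l) ∧
      (X.HasFieldOfModuli →
        (X.kind = .variety → FibStack.IsStack (FEt.topology k) X.models) →
        F.toFunctor.Full → F.toFunctor.Faithful →
        (∀ l : IntermediateField k K, X.IsFieldOfDefinition l ↔ Y.IsFieldOfDefinition l) ∧
        (X.HasDescentObstruction ↔ Y.HasDescentObstruction))) ∧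
    (∀ {𝒮 : Type u₁} [Category.{v₁} 𝒮] (J : GrothendieckTopology 𝒮)
      (𝒳 : BasedCategory.{v₂, u₂} 𝒮) (𝒴 : BasedCategory.{v₃, u₃} 𝒮) (F : BasedFunctor 𝒳 𝒴),
      FibStack.IsStack J 𝒳 → FibStack.IsLocallyNonempty J 𝒳 →
      FibStack.IsStack J 𝒴 → FibStack.IsLocallyConnected J 𝒴 → FibStack.IsCartesianFunctor F →
      F.toFunctor.Full → F.toFunctor.Faithful → FibStack.IsFiberwiseEssSurj F) := by
  refine ⟨fun X Y F ↦ ⟨fun hX ↦ hX.map F, fun l h ↦ h.map F,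
    fun hX l h ↦ hX.isFieldOfDefinition_map F h, fun hX hstack _ _ ↦ ?_⟩,
    fun J 𝒳 𝒴 F h𝒳 hne h𝒴 hconn hF _ _ ↦ h𝒳.isFiberwiseEssSurj h𝒴 hF hne hconn⟩
  have hiff := hX.isFieldOfDefinition_iff F hstack
  exact ⟨hiff, and_congr (iff_of_true hX (hX.map F)) (hiff ⊥).not⟩

theorem mainTheorem8 {k K : Type u} [Field k] [CharZero k] [Field K] [Algebra k K]
    [IsAlgClosure k K] :
    (∀ (X Y : DescentObject k K) (F : BasedFunctor X.models Y.models),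
      FibStack.IsCartesianFunctor F →
      (X.HasFieldOfModuli → Y.HasFieldOfModuli) ∧
      (∀ l : IntermediateField k K, X.HasModelOver l → Y.HasModelOver l) ∧
      (X.HasFieldOfModuli →
        ∀ l : IntermediateField k K, X.IsFieldOfDefinition l → Y.IsFieldOfDefinition l) ∧
      (X.HasFieldOfModuli →
        (X.kind = .variety → FibStack.IsStack (FEt.topology k) X.models) →
        (Y.kind = .variety → FibStack.IsStack (FEt.topology k) Y.models) →
        F.toFunctor.Full → F.toFunctor.Faithful →
        (∀ l : IntermediateField k K, X.IsFieldOfDefinition l ↔ Y.IsFieldOfDefinition l) ∧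
        (X.HasDescentObstruction ↔ Y.HasDescentObstruction))) ∧
    (∀ {𝒮 : Type u₁} [Category.{v₁} 𝒮] (J : GrothendieckTopology 𝒮)
      (𝒳 : BasedCategory.{v₂, u₂} 𝒮) (𝒴 : BasedCategory.{v₃, u₃} 𝒮) (F : BasedFunctor 𝒳 𝒴),
      FibStack.IsGerbe J 𝒳 → FibStack.IsGerbe J 𝒴 → FibStack.IsCartesianFunctor F →
      F.toFunctor.Full → F.toFunctor.Faithful → FibStack.IsFiberwiseEssSurj F) := by
  have := IsAlgClosure.isAlgebraic (R := k) (K := K)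
  have := IsAlgClosure.normal k K
  have : IsGalois k K := {}
  exact (mainTheorem8_general (k := k) (K := K)).imp
    (fun h X Y F _ ↦
      have ⟨hmoduli, hmodel, hdef, hiff⟩ := h X Y F
      ⟨hmoduli, hmodel, hdef, fun hX hstack _ ↦ hiff hX hstack⟩)
    (fun h _ _ J 𝒳 𝒴 F h𝒳 h𝒴 ↦
      h J 𝒳 𝒴 F h𝒳.isStack h𝒳.locally_nonempty h𝒴.isStack h𝒴.locally_connected)
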